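/- Let $G$ be a locally finite tree with a distinguished vertex $\rho$, let $p\in(0,1)$ and $q:=1-p$. Let $P_p$ be the law of static bond percolation on $G$ (each edge is open with probability $p$ and closed with probability $q$, independently), and let $\{\rho\leftrightarrow\infty\}$ be the event that the open cluster of $\rho$ is infinite. Dynamical percolation on $G$ with parameter $p$ is defined on some probability space $(\Omega,\mathcal F,\mathbf P)$: the states of the edges evolve as independent càdlàg continuous-time Markov chains on $\{\text{closed},\text{open}\}$, each of which starts from the open state with probability $p$ and from the closed state with probability $q$, flips from closed to open at rate $p$, and flips from open to closed at rate $q$. For $t\ge 0$ let $\{\rho\stackrel{t}{\leftrightarrow}\infty\}$ be the event that the open cluster of $\rho$ at time $t$ is infinite. Let $\partial G$ be the set of all infinite rays (injective infinite paths) that start at $\rho$. For $v,w\in\partial G$ let $|v\wedge w|\in\{0,1,2,\dots\}\cup\{\infty\}$ be the number of common initial edges of $v$ and $w$, i.e. the height of their greatest common ancestor, which is $\infty$ if $v=w$. Equip $\partial G$ with the metric $d(v,w)=e^{-|v\wedge w|}$, and define for $v,w\in\partial G$ and $s,t\ge 0$ $$h\big((v,s);(w,t)\big)=\Big(1+\frac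 qp\,e^{-|s-t|}\Big)^{|v\wedge w|}\in[1,\infty].$$ For $D\subseteq\mathbf R_+$ compact let $$\mathrm{Cap}_h(\partial G\times D)=\Big[\inf_{\mu}\iint h(x,y)\,\mu(dx)\,\mu(dy)\Big]^{-1},$$ where the infimum is over all Borel probability measures $\mu$ on $\partial G\times D$, $\inf\varnothing:=\infty$ and $1/\infty:=0$. Then for every compact set $D\subseteq\mathbf R_+$, $$\mathbf P\Big(\bigcup_{t\in D}\{\rho\stackrel{t}{\leftrightarrow}\infty\}\Big)\le 512\,\mathrm{Cap}_h(\partial G\times D),$$ where the left-hand side is read as an outer probability. If in addition $P_p\{\rho\leftrightarrow\infty\}=0$, then the event $\bigcup_{t\in D}\{\rho\stackrel{t}{\leftrightarrow}\infty\}$ is measurable with respect to the completion of $\mathbf P$, and $$\tfrac12\,\mathrm{Cap}_h(\partial G\times D)\le \mathbf P\Big(\bigcup_{t\in D}\{\rho\stackrel{t}{\leftrightarrow}\infty\}\Big).$$ -/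

import Mathlib

open MeasureTheory ProbabilityTheory Filter Topology
open scoped ENNReal NNReal unitInterval

namespace DynPerc

section Rays

variable {V : Type*} {G : SimpleGraph V} {ρ : V}

/-- An infinite ray of `G` emanating from `ρ`: an injective infinite path that starts at `ρ`.
The type `Ray G ρ` is the boundary `∂G` (with respect to the root `ρ`). -/
@[ext]
structure Ray (G : SimpleGraph V) (ρ : V) where
  /-- the vertices of the ray in order -/
  toFun : ℕ → V
  start : toFun 0 = ρ
  adj : ∀ n, G.Adj (toFun n) (toFun (n + 1))
  inj : Function.Injective toFun

/-- `|v ∧ w|`: the height of the last vertex up to which the rays `v` and `w` coincide (in a tree,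
this is their greatest common ancestor); it is `⊤` if `v = w`. -/
noncomputable def meetHeight (v w : Ray G ρ) : ℕ∞ :=
  ⨆ (n : ℕ) (_ : ∀ k ≤ n, v.toFun k = w.toFun k), (n : ℕ∞)

theorem le_meetHeight_iff (v w : Ray G ρ) (n : ℕ) :
    (n : ℕ∞) ≤ meetHeight v w ↔ ∀ k ≤ n, v.toFun k = w.toFun k := by
  constructor
  · intro h k hk
    by_contra hne
    have hle : meetHeight v w ≤ ((n - 1 : ℕ) : ℕ∞) := by
      refine iSup₂_le fun m hm => ?_
      have : m < k := by
        by_contra hlt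
        exact hne (hm k (not_lt.mp hlt))
      exact_mod_cast (by omega : m ≤ n - 1)
    have h1 : n ≤ n - 1 := by exact_mod_cast h.trans hle
    have h0 : k = 0 := by omega
    subst h0
    exact hne (v.start.trans w.start.symm)
  · intro h
    exact le_iSup₂_of_le n h le_rfl

theorem meetHeight_eq_top_iff (v w : Ray G ρ) : meetHeight v w = ⊤ ↔ v = w := by
  constructor
  · intro h
    ext n
    exact (le_meetHeight_iff v w n).1 (h ▸ le_top) n le_rfl
  · rintro rfl
    refine ENat.eq_top_iff_forall_ge.2 fun n => ?_
    exact (le_meetHeight_iff v v n).2 fun _ _ => rfl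

theorem meetHeight_comm (v w : Ray G ρ) : meetHeight v w = meetHeight w v := by
  simp only [meetHeight, eq_comm]

theorem min_meetHeight_le (u v w : Ray G ρ) :
    min (meetHeight u v) (meetHeight v w) ≤ meetHeight u w := by
  refine ENat.forall_natCast_le_iff_le.1 fun n hn => ?_
  obtain ⟨h1, h2⟩ := le_min_iff.1 hn
  rw [le_meetHeight_iff] at *
  exact fun k hk => (h1 k hk).trans (h2 k hk)

open Classical in
/-- The metric `d(v, w) = exp(-|v ∧ w|)` on `∂G`, with `exp(-∞) = 0`. -/
noncomputable def rayDist (v w : Ray G ρ) : ℝ :=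
  if meetHeight v w = ⊤ then 0 else Real.exp (-((meetHeight v w).toNat : ℝ))

theorem rayDist_nonneg (v w : Ray G ρ) : 0 ≤ rayDist v w := by
  unfold rayDist
  split_ifs
  · exact le_rfl
  · positivity

theorem rayDist_anti {v w v' w' : Ray G ρ} (h : meetHeight v w ≤ meetHeight v' w') :
    rayDist v' w' ≤ rayDist v w := by
  by_cases h' : meetHeight v' w' = ⊤
  · have : rayDist v' w' = 0 := if_pos h'
    rw [this]
    exact rayDist_nonneg v w
  · have h0 : meetHeight v w ≠ ⊤ := fun e => h' (top_le_iff.1 (e ▸ h))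
    unfold rayDist
    rw [if_neg h', if_neg h0]
    have := ENat.toNat_le_toNat h h'
    gcongr

noncomputable instance : MetricSpace (Ray G ρ) where
  dist := rayDist
  dist_self v := if_pos ((meetHeight_eq_top_iff v v).2 rfl)
  dist_comm v w := by
    unfold rayDist
    rw [meetHeight_comm]
  dist_triangle u v w := by
    have h := min_meetHeight_le u v w
    rcases min_le_iff.1 h with h | h
    · linarith [rayDist_anti h, rayDist_nonneg v w]
    · linarith [rayDist_anti h, rayDist_nonneg u v]
  eq_of_dist_eq_zero {v w} h := by
    change rayDist v w = 0 at h
    unfold rayDist at h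
    split_ifs at h with h1
    · exact (meetHeight_eq_top_iff v w).1 h1
    · exact absurd h (Real.exp_pos _).ne'

/-- `∂G` carries its Borel σ-algebra. -/
noncomputable instance : MeasurableSpace (Ray G ρ) := borel _

instance : BorelSpace (Ray G ρ) := ⟨rfl⟩

end Rays

section Capacity

variable {S : Type*} [MeasurableSpace S]

/-- The `f`-energy `I_f(μ) = ∬ f(x, y) μ(dx) μ(dy)`. -/
noncomputable def energy (f : S → S → ℝ≥0∞) (μ : Measure S) : ℝ≥0∞ :=
  ∫⁻ x, ∫⁻ y, f x y ∂μ ∂μ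

/-- The `f`-capacity of `F`: the inverse of the infimum of `I_f(μ)` over all probability measures
`μ` carried by `F`. In `ℝ≥0∞` the infimum over the empty set is `∞`, and `∞⁻¹ = 0`. -/
noncomputable def capacity (f : S → S → ℝ≥0∞) (F : Set S) : ℝ≥0∞ :=
  (⨅ (μ : ProbabilityMeasure S) (_ : (μ : Measure S) Fᶜ = 0), energy f (μ : Measure S))⁻¹

end Capacity

section Kernel

variable {V : Type*} {G : SimpleGraph V} {ρ : V}

open Classical in
/-- The kernel `h((v, s); (w, t)) = (1 + (q / p) exp(-|s - t|)) ^ |v ∧ w|` with `q = 1 - p`.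
For `0 < p < 1` the base exceeds `1`, so that the power is `∞` when `|v ∧ w| = ∞`. -/
noncomputable def kernelH (p : ℝ) (x y : Ray G ρ × ℝ≥0) : ℝ≥0∞ :=
  if meetHeight x.1 y.1 = ⊤ then ⊤
  else ENNReal.ofReal
    ((1 + (1 - p) / p * Real.exp (-|(x.2 : ℝ) - (y.2 : ℝ)|)) ^ (meetHeight x.1 y.1).toNat)

end Kernel

section Percolation

variable {V : Type*}

/-- The spanning subgraph of open edges of the configuration `η` (`true` means open). -/
def openGraph (G : SimpleGraph V) (η : G.edgeSet → Bool) : SimpleGraph V where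
  Adj u v := ∃ h : G.Adj u v, η ⟨s(u, v), h⟩ = true
  symm := ⟨by
    rintro u v ⟨h, hη⟩
    refine ⟨h.symm, ?_⟩
    rw [← hη]
    congr 2
    exact Sym2.eq_swap⟩
  loopless := ⟨fun u ⟨h, _⟩ => G.loopless.irrefl u h⟩

/-- `ρ ↔ ∞` in the configuration `η`: the open cluster of `ρ` is infinite. -/
def Percolates (G : SimpleGraph V) (ρ : V) (η : G.edgeSet → Bool) : Prop :=
  {v : V | (openGraph G η).Reachable ρ v}.Infinite

/-- `P_p`: edges are independently open with probability `p` and closed with probability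
`1 - p`. -/
noncomputable def percolationMeasure (G : SimpleGraph V) (p : I) : Measure (G.edgeSet → Bool) :=
  Measure.infinitePi fun _ => bernoulliMeasure true false p

end Percolation

section Dynamics

/-- The infinitesimal generator of the two-state edge dynamics: closed (`false`) becomes open
(`true`) at rate `p`, and open becomes closed at rate `1 - p`. -/
def edgeGenerator (p : ℝ) : Matrix Bool Bool ℝ
  | false, false => -p
  | false, true => p
  | true, false => 1 - p
  | true, true => -(1 - p)

/-- The transition probabilities `P_t = exp(t Q)` of the edge dynamics. -/
noncomputable def edgeTransition (p : ℝ) (t : ℝ) : Matrix Bool Bool ℝ :=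
  NormedSpace.exp (t • edgeGenerator p)

/-- `Y` is the edge process: a càdlàg continuous-time Markov chain on `{closed, open}`
with generator `edgeGenerator p`, started from open with probability `p` and closed with
probability `1 - p`. -/
structure IsEdgeProcess {Ω : Type*} [MeasurableSpace Ω] (p : I) (P : Measure Ω)
    (Y : ℝ≥0 → Ω → Bool) : Prop where
  measurable : ∀ t, Measurable (Y t)
  fdd : ∀ (n : ℕ) (t : Fin (n + 1) → ℝ≥0), Monotone t → t 0 = 0 → ∀ a : Fin (n + 1) → Bool,
    P.real {ω | ∀ i, Y (t i) ω = a i} =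
      (bernoulliMeasure true false p).real {a 0} *
        ∏ i : Fin n, edgeTransition p ((t i.succ : ℝ) - (t i.castSucc : ℝ))
          (a i.castSucc) (a i.succ)
  cadlag : ∀ᵐ ω ∂P, ∀ t : ℝ≥0,
    ContinuousWithinAt (fun s => Y s ω) (Set.Ici t) t ∧
      ∃ b, Tendsto (fun s => Y s ω) (𝓝[<] t) (𝓝 b)

/-- `X` is dynamical percolation on `G` with parameter `p`: the edges evolve independently,
each one as an edge process. -/
structure IsDynamicalPercolation {V Ω : Type*} [MeasurableSpace Ω] (G : SimpleGraph V) (p : I)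
    (P : Measure Ω) (X : G.edgeSet → ℝ≥0 → Ω → Bool) : Prop where
  edge : ∀ e, IsEdgeProcess p P (X e)
  indep : iIndepFun (fun e ω t => X e t ω) P

/-- The event that `ρ` percolates at some time `t ∈ D`. -/
def percolatesDuring {V Ω : Type*} (G : SimpleGraph V) (ρ : V)
    (X : G.edgeSet → ℝ≥0 → Ω → Bool) (D : Set ℝ≥0) : Set Ω :=
  ⋃ t ∈ D, {ω | Percolates G ρ fun e => X e t ω}

end Dynamics

end DynPerc

/-! Both bounds rest on one random variable. For a probability `μ` on pairs (vertex at level n,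
time), let Z (`openMass`) be the `μ`-mass of the pairs whose path from the root is open at that
time, each weighted by the inverse of its probability. Then E Z = 1. An edge is open at both s and t
with probability p²(1 + (q/p)exp(-|s-t|)), so by independence of the edges E Z² is exactly the
h-energy of `μ` with the meet height truncated at n (`EdgeLaw.mean_openMass_sq`).

Lower bound: Z vanishes unless level n is reached, so Cauchy–Schwarz bounds the probability of
reaching level n at some time in D from below by the inverse energy; rounding the times to a finite
net costs the factor 2. To let n tend to infinity, one needs that reaching every level during D
forces percolation at one time of D. By compactness of D and right-continuity, this fails only if
some edge closes at a time t such that the left-limit configuration at t percolates. An edge closes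
at rate at most 1 whatever the present configuration, so up to time T this has probability at most T
times the static probability of reaching level n, which tends to 0 when there is no static
percolation (`IsDynamicalPercolation.measure_closing_eq_zero`,
`mem_percolatesDuring_or_gridClosing`).

Upper bound: whenever some pair is open, select one, and let `μ` be the conditional law of the
selected pair. Order the vertices of level n as in a planar drawing. Projecting Z on the edges of
paths not after v, and then on the times not after t, gives at an open pair (v, t) at least the part
of the `μ`-potential coming from the quadrant beyond (v, t). Doob's L² inequality in each of the two
parameters controls the supremum of these projections (`exists_quadrant_bound`). Adding the four
quadrants and applying Cauchy–Schwarz bounds hitting probability times energy by 256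
(`exists_energy_le`). Approximating D by finite sets of times costs a factor 2, and a weak limit of
the measures as n grows gives the capacity of the full boundary. -/

namespace DynPerc

/-! ### Conditional expectation and Doob's inequality on finite spaces -/

section FiniteExpectation

variable {X ι : Type*} [Fintype X]

/-- The expectation of `f` with respect to the weights `w` on a finite type. -/
def mean (w f : X → ℝ) : ℝ := ∑ x, w x * f x

open Classical in
/-- The conditional expectation of `f` given the classes of the equivalence relation `r`, with
respect to the weights `w` on a finite type. -/
noncomputable def cexp (w : X → ℝ) (r : X → X → Prop) (f : X → ℝ) (x : X) : ℝ :=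
  (∑ y with r x y, w y * f y) / ∑ y with r x y, w y

variable {w : X → ℝ} {r : X → X → Prop}

/-- Comparison is demanded only on the support of `w`: on classes of weight zero `cexp` is 0 / 0 =
0, and the formulas for it proved below fail there. -/
theorem mean_mono (hw : 0 ≤ w) {f g : X → ℝ} (h : ∀ x, w x ≠ 0 → f x ≤ g x) :
    mean w f ≤ mean w g := by
  refine Finset.sum_le_sum fun x _ => ?_
  by_cases hx : w x = 0
  · simp [hx]
  · exact mul_le_mul_of_nonneg_left (h x hx) (hw x)

theorem mean_sub (f g : X → ℝ) : mean w (fun x => f x - g x) = mean w f - mean w g := by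
  simp only [mean, mul_sub, Finset.sum_sub_distrib]

theorem mean_const_mul (c : ℝ) (f : X → ℝ) : mean w (fun x => c * f x) = c * mean w f := by
  simp only [mean, Finset.mul_sum]
  exact Finset.sum_congr rfl fun x _ => by ring

theorem mean_sum (s : Finset ι) (f : ι → X → ℝ) :
    mean w (fun x => ∑ i ∈ s, f i x) = ∑ i ∈ s, mean w (f i) := by
  simp only [mean, Finset.mul_sum]
  exact Finset.sum_comm

theorem mean_nonneg (hw : 0 ≤ w) {f : X → ℝ} (h : ∀ x, w x ≠ 0 → 0 ≤ f x) : 0 ≤ mean w f := by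
  have := mean_mono hw (f := fun _ => 0) h
  simpa [mean] using this

open Classical in
theorem cexp_congr (hr : Equivalence r) (f : X → ℝ) {x y : X} (h : r x y) :
    cexp w r f x = cexp w r f y := by
  have : (Finset.univ.filter fun z => r x z) = Finset.univ.filter fun z => r y z :=
    Finset.filter_congr fun z _ => ⟨hr.trans (hr.symm h), hr.trans h⟩
  rw [cexp, cexp, this]

theorem cexp_mono (hw : 0 ≤ w) {f g : X → ℝ} (h : ∀ x, w x ≠ 0 → f x ≤ g x) (x : X) :
    cexp w r f x ≤ cexp w r g x := by
  refine div_le_div_of_nonneg_right (Finset.sum_le_sum fun y _ => ?_)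
    (Finset.sum_nonneg fun y _ => hw y)
  by_cases hy : w y = 0
  · simp [hy]
  · exact mul_le_mul_of_nonneg_left (h y hy) (hw y)

theorem cexp_const_mul_sum (s : Finset ι) (c : ι → ℝ) (f : ι → X → ℝ) (x : X) :
    cexp w r (fun x => ∑ i ∈ s, c i * f i x) x = ∑ i ∈ s, c i * cexp w r (f i) x := by
  simp only [cexp, Finset.mul_sum, mul_div_assoc']
  rw [Finset.sum_comm, Finset.sum_div]
  refine Finset.sum_congr rfl fun i _ => ?_
  congr 1
  exact Finset.sum_congr rfl fun y _ => by ring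

theorem cexp_nonneg (hw : 0 ≤ w) {f : X → ℝ} (h : ∀ x, w x ≠ 0 → 0 ≤ f x) (x : X) :
    0 ≤ cexp w r f x :=
  div_nonneg (Finset.sum_nonneg fun y _ => by
    by_cases hy : w y = 0
    · simp [hy]
    · exact mul_nonneg (hw y) (h y hy)) (Finset.sum_nonneg fun y _ => hw y)

-- The conditional expectation is an orthogonal projection: exchange the double sum over equivalent
-- pairs. A class of total weight zero contributes nothing, since each of its points then has weight
-- zero.
open Classical in
theorem mean_mul_cexp (hw : 0 ≤ w) (hr : Equivalence r) (f : X → ℝ) {g : X → ℝ}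
    (hg : ∀ x y, r x y → g x = g y) :
    mean w (fun x => g x * cexp w r f x) = mean w (fun x => g x * f x) := by
  have h1 : ∀ x, w x * (g x * cexp w r f x) =
      ∑ y, if r x y then w x * w y * f y * g y / (∑ z with r y z, w z) else 0 := by
    intro x
    rw [← Finset.sum_filter, cexp, mul_div_assoc', mul_div_assoc', Finset.mul_sum,
      Finset.mul_sum, Finset.sum_div]
    refine Finset.sum_congr rfl fun y hy => ?_
    have hxy : r x y := (Finset.mem_filter.1 hy).2
    have : ∀ z, r x z ↔ r y z := fun z => ⟨hr.trans (hr.symm hxy), hr.trans hxy⟩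
    simp only [this, hg x y hxy]
    ring
  simp only [mean, h1]
  rw [Finset.sum_comm]
  refine Finset.sum_congr rfl fun y _ => ?_
  have h2 : ∀ x, r x y ↔ r y x := fun x => ⟨hr.symm, hr.symm⟩
  have h3 : ∀ x, w x * w y * f y * g y / (∑ z with r y z, w z) =
    w x * (w y * f y * g y / (∑ z with r y z, w z)) := fun x => by ring
  simp only [h2, h3]
  rw [← Finset.sum_filter, ← Finset.sum_mul]
  by_cases h0 : ∑ z with r y z, w z = 0
  · have : w y = 0 :=
      (Finset.sum_eq_zero_iff_of_nonneg fun z _ => hw z).1 h0 y (by simp [hr.refl y])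
    simp [this]
  · field_simp

/-- Doob's maximal inequality in `L²`, for the conditional expectations given a filtration that is
indexed by a finite type. -/
theorem exists_maximal {A : Type*} [LinearOrder A] [Fintype ι] (hw : 0 ≤ w) (a : ι → A)
    (r : ι → X → X → Prop) (hr : ∀ i, Equivalence (r i))
    (hanti : ∀ i j, a i ≤ a j → ∀ x y, r j x y → r i x y) (f : X → ℝ) :
    ∃ S : X → ℝ, 0 ≤ S ∧ (∀ i x, cexp w (r i) f x ≤ S x) ∧
      mean w (fun x => S x ^ 2) ≤ 4 * mean w fun x => f x ^ 2 := by
  classical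
  -- Indices are added in increasing order of `a`, with `S` the running maximum (started at 0). The
  -- third clause is adaptedness; the last is the form of Doob's inequality that passes through the
  -- induction.
  have key : ∀ s : Finset ι, ∃ S : X → ℝ, 0 ≤ S ∧ (∀ i ∈ s, ∀ x, cexp w (r i) f x ≤ S x) ∧
      (∀ j, (∀ i ∈ s, a i ≤ a j) → ∀ x y, r j x y → S x = S y) ∧
      mean w (fun x => S x ^ 2) ≤ 2 * mean w fun x => S x * f x := by
    intro s
    induction s using Finset.induction_on_max_value a with
    | empty => exact ⟨0, le_rfl, by simp, by simp, by simp [mean]⟩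
    | insert i s _ hmax ih =>
      obtain ⟨S, h0, hle, hmeas, hS⟩ := ih
      have hM : ∀ x y, r i x y → max (S x) (cexp w (r i) f x) = max (S y) (cexp w (r i) f y) :=
        fun x y hxy => by rw [hmeas i hmax x y hxy, cexp_congr (hr i) f hxy]
      refine ⟨fun x => max (S x) (cexp w (r i) f x), fun x => le_max_of_le_left (h0 x), ?_, ?_, ?_⟩
      · intro j hj x
        rcases Finset.mem_insert.1 hj with rfl | hj
        · exact le_max_right _ _
        · exact le_max_of_le_left (hle j hj x)
      · exact fun j hj x y hxy => hM x y
          (hanti i j (hj i (Finset.mem_insert_self i s)) x y hxy)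
      -- The increment of the running maximum is constant on the classes of `r i`, so the
      -- conditional expectation multiplying it may be replaced by `f`. The increment is nonzero
      -- only where the new maximum equals the conditional expectation M, and there M² - S² ≤ 2(M -
      -- S)M.
      · have h1 := mean_mul_cexp hw (hr i) f
          (g := fun x => max (S x) (cexp w (r i) f x) - S x)
          (fun x y hxy => by rw [hM x y hxy, hmeas i hmax x y hxy])
        have h2 : mean w (fun x => max (S x) (cexp w (r i) f x) ^ 2 - S x ^ 2) ≤
            mean w (fun x => 2 * ((max (S x) (cexp w (r i) f x) - S x) * cexp w (r i) f x)) := by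
          refine mean_mono hw fun x _ => ?_
          rcases le_total (S x) (cexp w (r i) f x) with h | h
          · rw [max_eq_right h]
            nlinarith [sq_nonneg (cexp w (r i) f x - S x)]
          · rw [max_eq_left h]
            simp
        rw [mean_const_mul, h1, mean_sub] at h2
        have h3 : mean w (fun x => (max (S x) (cexp w (r i) f x) - S x) * f x) =
            mean w (fun x => max (S x) (cexp w (r i) f x) * f x) - mean w (fun x => S x * f x) := by
          rw [← mean_sub]
          simp only [sub_mul]
        rw [h3] at h2
        linarith
  obtain ⟨S, h0, hle, -, hS⟩ := key Finset.univ
  refine ⟨S, h0, fun i => hle i (Finset.mem_univ i), ?_⟩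
  -- Expanding (S - 2f)² ≥ 0 turns E S² ≤ 2 E(S f) into E S² ≤ 4 E f² without square roots.
  have h1 : mean w (fun x => 4 * (S x * f x) - S x ^ 2) ≤ mean w (fun x => 4 * f x ^ 2) :=
    mean_mono hw fun x _ => by nlinarith [sq_nonneg (S x - 2 * f x)]
  rw [mean_sub, mean_const_mul, mean_const_mul] at h1
  linarith

end FiniteExpectation

/-! ### Product weights -/

section Product

variable {E X : Type*} [Fintype E]

/-- The product weights. -/
def prodWeight (w : E → X → ℝ) (η : E → X) : ℝ := ∏ e, w e (η e)

theorem prodWeight_nonneg {w : E → X → ℝ} (hw : ∀ e, 0 ≤ w e) : 0 ≤ prodWeight w :=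
  fun η => Finset.prod_nonneg fun e _ => hw e (η e)

variable [DecidableEq E] [Fintype X]

theorem mean_prodWeight_prod (w : E → X → ℝ) (g : E → X → ℝ) :
    mean (prodWeight w) (fun η => ∏ e, g e (η e)) = ∏ e, mean (w e) (g e) := by
  simp only [mean, prodWeight, ← Finset.prod_mul_distrib]
  rw [Finset.prod_univ_sum, Fintype.piFinset_univ]

-- A class of the product relation is a product of classes, so numerator and denominator both factor
-- over the edges.
open Classical in
theorem cexp_prodWeight_prod (w : E → X → ℝ) (r : E → X → X → Prop) (g : E → X → ℝ) (η : E → X) :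
    cexp (prodWeight w) (fun η ξ => ∀ e, r e (η e) (ξ e)) (fun η => ∏ e, g e (η e)) η =
      ∏ e, cexp (w e) (r e) (g e) (η e) := by
  have h : ∀ f : E → X → ℝ, ∑ ξ : E → X with ∀ e, r e (η e) (ξ e), ∏ e, f e (ξ e) =
      ∏ e, ∑ y with r e (η e) y, f e y := by
    intro f
    rw [Finset.prod_univ_sum]
    refine Finset.sum_congr ?_ fun _ _ => rfl
    ext ξ
    simp
  simp only [cexp, prodWeight, ← Finset.prod_mul_distrib, Finset.prod_div_distrib]
  rw [h w, h fun e x => w e x * g e x]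

end Product

set_option linter.unusedSectionVars false

/-! ### Second moment and hitting estimate in the finite model -/

section FiniteModel

/-- The indicator of an open state. -/
def ind (b : Bool) : ℝ := if b then 1 else 0

theorem ind_nonneg (b : Bool) : 0 ≤ ind b := by
  unfold ind
  split_ifs <;> norm_num

variable {E L T : Type*} [Fintype T] [DecidableEq T]

/-- The one- and two-point functions of a random path `T → Bool` with weights `w`. -/
structure EdgeLaw (p : ℝ) (r : T → T → ℝ) (w : (T → Bool) → ℝ) : Prop where
  nonneg : 0 ≤ w
  total : mean w (fun _ => 1) = 1
  one : ∀ j, mean w (fun x => ind (x j)) = p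
  two : ∀ i j, mean w (fun x => ind (x i) * ind (x j)) = p ^ 2 * r i j

open Classical in
/-- One-sided Markov bound: given the states up to `k`, with state open at `k`, the state at `j` is
open with probability at least `p * r k j`. -/
def EdgeMarkov {B : Type*} [LinearOrder B] (τ : T → B) (p : ℝ) (r : T → T → ℝ)
    (w : (T → Bool) → ℝ) : Prop :=
  ∀ k j, τ k ≤ τ j → ∀ x : T → Bool, x k = true →
    p * r k j * (∑ y with ∀ i, τ i ≤ τ k → x i = y i, w y) ≤
      ∑ y with ∀ i, τ i ≤ τ k → x i = y i, w y * ind (y j)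

variable [Fintype E] [DecidableEq E]

theorem prod_ind_eq (s : Finset E) (η : E → T → Bool) (j : T) :
    ∏ e ∈ s, ind (η e j) = ∏ e, if e ∈ s then ind (η e j) else 1 := by
  rw [Fintype.prod_ite_mem]

/-- Revealing the whole history of the edges in `S` freezes their factors; each other edge of `s` is
independent of this and averages to `p`. -/
theorem EdgeLaw.cexp_restrict {p : ℝ} {r : T → T → ℝ} {w : E → (T → Bool) → ℝ}
    (hw : ∀ e, EdgeLaw p r (w e)) (s S : Finset E) (j : T) {η : E → T → Bool}
    (hη : prodWeight w η ≠ 0) :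
    cexp (prodWeight w) (fun η ξ => ∀ e, e ∈ S → η e = ξ e) (fun η => ∏ e ∈ s, ind (η e j)) η =
      p ^ (s \ S).card * ∏ e ∈ s ∩ S, ind (η e j) := by
  classical
  have h0 : ∀ e, w e (η e) ≠ 0 := fun e he => hη (Finset.prod_eq_zero (Finset.mem_univ e) he)
  simp only [prod_ind_eq]
  rw [cexp_prodWeight_prod w (fun e x y => e ∈ S → x = y)
    (fun e x => if e ∈ s then ind (x j) else 1) η]
  have h1 : p ^ (s \ S).card = ∏ e, if e ∈ s \ S then p else 1 := by
    rw [Fintype.prod_ite_mem, Finset.prod_const]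
  rw [h1, ← Finset.prod_mul_distrib]
  refine Finset.prod_congr rfl fun e _ => ?_
  by_cases hS : e ∈ S
  · have : (Finset.univ.filter fun y => e ∈ S → η e = y) = {η e} := by
      ext y
      simp [hS, eq_comm]
    simp only [cexp, this, Finset.sum_singleton]
    rw [mul_div_cancel_left₀ _ (h0 e)]
    simp [hS]
  · have h2 := (hw e).total
    have h3 := (hw e).one j
    simp only [mean, mul_one] at h2 h3
    by_cases hs : e ∈ s <;> simp [cexp, hS, hs, h2, h3]

/-- The past of all edges is a product relation, so the estimate is edgewise: `EdgeMarkov` on `s`,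
and the trivial factor 1 elsewhere. -/
theorem EdgeLaw.le_cexp_past {B : Type*} [LinearOrder B] {τ : T → B}
    {p : ℝ} {r : T → T → ℝ} {w : E → (T → Bool) → ℝ} (hp : 0 ≤ p) (hr : ∀ i j, 0 ≤ r i j)
    (hw : ∀ e, EdgeLaw p r (w e)) (hm : ∀ e, EdgeMarkov τ p r (w e)) (s : Finset E) {k j : T}
    (hkj : τ k ≤ τ j) {η : E → T → Bool} (hη : prodWeight w η ≠ 0) (hs : ∀ e ∈ s, η e k = true) :
    (p * r k j) ^ s.card ≤ cexp (prodWeight w)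
      (fun η ξ => ∀ e, ∀ i, τ i ≤ τ k → η e i = ξ e i) (fun η => ∏ e ∈ s, ind (η e j)) η := by
  classical
  have h0 : ∀ e, w e (η e) ≠ 0 := fun e he => hη (Finset.prod_eq_zero (Finset.mem_univ e) he)
  simp only [prod_ind_eq]
  rw [cexp_prodWeight_prod w (fun e x y => ∀ i, τ i ≤ τ k → x i = y i)
    (fun e x => if e ∈ s then ind (x j) else 1) η]
  have h1 : (p * r k j) ^ s.card = ∏ e, if e ∈ s then p * r k j else 1 := by
    rw [Fintype.prod_ite_mem, Finset.prod_const]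
  rw [h1]
  refine Finset.prod_le_prod (fun e _ => ?_) fun e _ => ?_
  · split_ifs
    · exact mul_nonneg hp (hr k j)
    · exact zero_le_one
  · have hpos : 0 < ∑ y with ∀ i, τ i ≤ τ k → η e i = y i, w e y := by
      refine Finset.sum_pos' (fun y _ => (hw e).nonneg y) ⟨η e, by simp, ?_⟩
      exact lt_of_le_of_ne ((hw e).nonneg _) (h0 e).symm
    unfold cexp
    by_cases hes : e ∈ s
    · simp only [hes, if_true]
      rw [le_div_iff₀ hpos]
      exact hm e k j hkj (η e) (hs e hes)
    · simp only [hes, if_false, mul_one]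
      rw [div_self hpos.ne']

/-- The mass that `μ` gives to the pairs `(v, j)` such that the path to `v` is open at time `j`,
normalised to have expectation `1`. -/
noncomputable def openMass [Fintype L] (p : ℝ) (path : L → Finset E) (μ : L × T → ℝ) (η : E → T → Bool) : ℝ :=
  ∑ y, μ y * (p ^ (path y.1).card)⁻¹ * ∏ e ∈ path y.1, ind (η e y.2)

/-- The two-parameter maximal inequality. Spatial and temporal projections are applied one after the
other, and Doob's constant 4 enters once for each, giving 16. The bound holds at all open pairs
simultaneously, so a pair may later be selected in any manner. -/
theorem exists_quadrant_bound [Fintype L] {A B : Type*} [LinearOrder A] [LinearOrder B] {α : L → A}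
    {τ : T → B} {p : ℝ} {r : T → T → ℝ} {w : E → (T → Bool) → ℝ} (hp : 0 < p)
    (hr : ∀ i j, 0 ≤ r i j) (hw : ∀ e, EdgeLaw p r (w e)) (hm : ∀ e, EdgeMarkov τ p r (w e))
    {path : L → Finset E}
    (hplanar : ∀ u v w, α u ≤ α v → α v ≤ α w → path u ∩ path w ⊆ path v)
    {μ : L × T → ℝ} (hμ : 0 ≤ μ) :
    ∃ S : (E → T → Bool) → ℝ, 0 ≤ S ∧
      mean (prodWeight w) (fun η => S η ^ 2) ≤
        16 * mean (prodWeight w) (fun η => openMass p path μ η ^ 2) ∧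
      ∀ η, prodWeight w η ≠ 0 → ∀ v k, (∀ e ∈ path v, η e k = true) →
        ∑ y : L × T, (if α v ≤ α y.1 ∧ τ k ≤ τ y.2 then
          μ y * r k y.2 ^ (path v ∩ path y.1).card else 0) ≤ S η := by
  classical
  have hW : 0 ≤ prodWeight w := prodWeight_nonneg fun e => (hw e).nonneg
  -- The edges on paths to vertices not after `v`. They increase with `α v`, which makes the spatial
  -- projections a filtration.
  set U : L → Finset E := fun v => (Finset.univ.filter fun u => α u ≤ α v).biUnion path with hU
  have hUmem : ∀ v e, e ∈ U v ↔ ∃ u, α u ≤ α v ∧ e ∈ path u := by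
    intro v e
    simp [hU]
  obtain ⟨G, hG0, hG, hG2⟩ := exists_maximal hW α (fun v (η ξ : E → T → Bool) =>
      ∀ e, e ∈ U v → η e = ξ e)
    (fun v => ⟨fun _ _ _ => rfl, fun h e he => (h e he).symm, fun h h' e he =>
      (h e he).trans (h' e he)⟩)
    (fun u v huv η ξ h e he => by
      obtain ⟨u', hu', he'⟩ := (hUmem u e).1 he
      exact h e ((hUmem v e).2 ⟨u', hu'.trans huv, he'⟩)) (openMass p path μ)
  obtain ⟨S, hS0, hS, hS2⟩ := exists_maximal hW τ (fun k (η ξ : E → T → Bool) =>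
      ∀ e, ∀ i, τ i ≤ τ k → η e i = ξ e i)
    (fun k => ⟨fun _ _ _ _ => rfl, fun h e i hi => (h e i hi).symm, fun h h' e i hi =>
      (h e i hi).trans (h' e i hi)⟩)
    (fun k l hkl η ξ h e i hi => h e i (hi.trans hkl)) G
  refine ⟨S, hS0, by linarith, fun η hη v k hv => ?_⟩
  refine le_trans ?_ (hS k η)
  -- What remains of the coefficient of `y` once the edges outside `U v` have been averaged. Terms
  -- outside the quadrant are dropped, as all terms are nonnegative.
  set C : L × T → ℝ := fun y => if α v ≤ α y.1 ∧ τ k ≤ τ y.2 then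
    μ y * (p ^ (path y.1).card)⁻¹ * p ^ (path y.1 \ U v).card else 0 with hC
  have hC0 : ∀ y, 0 ≤ C y := fun y => by
    have := hμ y
    simp only [hC]
    split_ifs
    · have h : 0 ≤ μ y := hμ y
      positivity
    · exact le_rfl
  have step1 : ∀ ξ, prodWeight w ξ ≠ 0 →
      ∑ y : L × T, C y * ∏ e ∈ path y.1 ∩ U v, ind (ξ e y.2) ≤ G ξ := by
    intro ξ hξ
    refine le_trans ?_ (hG v ξ)
    unfold openMass
    rw [cexp_const_mul_sum]
    refine Finset.sum_le_sum fun y _ => ?_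
    rw [EdgeLaw.cexp_restrict hw _ _ _ hξ, ← mul_assoc]
    refine mul_le_mul_of_nonneg_right ?_ (Finset.prod_nonneg fun _ _ => ind_nonneg _)
    simp only [hC]
    split_ifs
    · exact le_rfl
    · have h : 0 ≤ μ y := hμ y
      positivity
  refine le_trans ?_ (cexp_mono hW step1 η)
  rw [cexp_const_mul_sum]
  refine Finset.sum_le_sum fun y _ => ?_
  by_cases hy : α v ≤ α y.1 ∧ τ k ≤ τ y.2
  -- Planarity enters only here: an edge of the path to `y.1` already revealed by a vertex not after
  -- `v` lies on the path to `v`, hence is open at time `k`.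
  · have hinter : path y.1 ∩ U v = path v ∩ path y.1 := by
      ext e
      simp only [Finset.mem_inter, hUmem]
      constructor
      · rintro ⟨h1, u, hu, h2⟩
        exact ⟨hplanar u v y.1 hu hy.1 (Finset.mem_inter.2 ⟨h2, h1⟩), h1⟩
      · rintro ⟨h1, h2⟩
        exact ⟨h2, v, le_rfl, h1⟩
    have hle := EdgeLaw.le_cexp_past hp.le hr hw hm (path y.1 ∩ U v) hy.2 hη
      (fun e he => hv e (Finset.mem_inter.1 (hinter ▸ he)).1)
    refine le_trans (le_of_eq ?_) (mul_le_mul_of_nonneg_left hle (hC0 y))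
    rw [if_pos hy]
    simp only [hC]
    rw [if_pos hy, mul_pow, ← hinter]
    have hcard : (path y.1).card = (path y.1 \ U v).card + (path y.1 ∩ U v).card := by
      rw [Finset.card_sdiff_add_card_inter]
    rw [hcard, pow_add]
    field_simp
  · rw [if_neg hy]
    exact mul_nonneg (hC0 y) (cexp_nonneg hW (fun ξ _ =>
      Finset.prod_nonneg fun _ _ => ind_nonneg _) η)

/-- By independence: a shared edge contributes p² r, an edge of exactly one of the sets contributes
p. -/
theorem EdgeLaw.mean_prod_ind {p : ℝ} {r : T → T → ℝ} {w : E → (T → Bool) → ℝ}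
    (hw : ∀ e, EdgeLaw p r (w e)) (s t : Finset E) (i j : T) :
    mean (prodWeight w) (fun η => (∏ e ∈ s, ind (η e i)) * ∏ e ∈ t, ind (η e j)) =
      p ^ s.card * p ^ t.card * r i j ^ (s ∩ t).card := by
  simp only [prod_ind_eq, ← Finset.prod_mul_distrib]
  rw [mean_prodWeight_prod w (fun e x => (if e ∈ s then ind (x i) else 1) *
    if e ∈ t then ind (x j) else 1)]
  have h : ∀ (a : ℝ) (u : Finset E), a ^ u.card = ∏ e, if e ∈ u then a else 1 := fun a u => by
    rw [Fintype.prod_ite_mem, Finset.prod_const]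
  rw [h, h, h, ← Finset.prod_mul_distrib, ← Finset.prod_mul_distrib]
  refine Finset.prod_congr rfl fun e _ => ?_
  by_cases hs : e ∈ s <;> by_cases ht : e ∈ t <;>
    simp [hs, ht, (hw e).one, (hw e).two, (hw e).total, sq]

/-- On expanding the square, the normalisation cancels all powers of p, and only the correlation
factor r of each shared edge survives. -/
theorem EdgeLaw.mean_openMass_sq [Fintype L] {p : ℝ} (hp : 0 < p) {r : T → T → ℝ}
    {w : E → (T → Bool) → ℝ} (hw : ∀ e, EdgeLaw p r (w e)) (path : L → Finset E)
    (μ : L × T → ℝ) :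
    mean (prodWeight w) (fun η => openMass p path μ η ^ 2) =
      ∑ x, ∑ y, μ x * μ y * r x.2 y.2 ^ (path x.1 ∩ path y.1).card := by
  have h : ∀ η : E → T → Bool, openMass p path μ η ^ 2 = ∑ x, ∑ y,
      (μ x * (p ^ (path x.1).card)⁻¹ * (μ y * (p ^ (path y.1).card)⁻¹)) *
        ((∏ e ∈ path x.1, ind (η e x.2)) * ∏ e ∈ path y.1, ind (η e y.2)) := by
    intro η
    rw [sq, openMass, Finset.sum_mul_sum]
    refine Finset.sum_congr rfl fun x _ => Finset.sum_congr rfl fun y _ => ?_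
    ring
  simp only [h]
  rw [mean_sum]
  refine Finset.sum_congr rfl fun x _ => ?_
  rw [mean_sum]
  refine Finset.sum_congr rfl fun y _ => ?_
  rw [mean_const_mul, EdgeLaw.mean_prod_ind hw]
  field_simp

theorem EdgeLaw.mean_openMass [Fintype L] {p : ℝ} (hp : 0 < p) {r : T → T → ℝ}
    {w : E → (T → Bool) → ℝ} (hw : ∀ e, EdgeLaw p r (w e)) (path : L → Finset E)
    (μ : L × T → ℝ) :
    mean (prodWeight w) (openMass p path μ) = ∑ x, μ x := by
  have h := mean_sum (w := prodWeight w) (Finset.univ : Finset (L × T)) (fun y η =>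
    μ y * (p ^ (path y.1).card)⁻¹ * ∏ e ∈ path y.1, ind (η e y.2))
  change mean (prodWeight w) (fun η => openMass p path μ η) = _
  simp only [openMass]
  rw [h]
  refine Finset.sum_congr rfl fun y _ => ?_
  rw [mean_const_mul]
  have := EdgeLaw.mean_prod_ind hw (path y.1) ∅ y.2 y.2
  simp only [Finset.prod_empty, mul_one, Finset.card_empty, pow_zero, Finset.inter_empty] at this
  rw [this]
  field_simp

/-- The configurations for which some path is open at some time. -/
def HitSet (path : L → Finset E) (η : E → T → Bool) : Prop :=
  ∃ x : L × T, ∀ e ∈ path x.1, η e x.2 = true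

theorem openMass_eq_zero [Fintype L] {p : ℝ} {path : L → Finset E} {μ : L × T → ℝ}
    {η : E → T → Bool} (h : ¬ HitSet path η) : openMass p path μ η = 0 := by
  refine Finset.sum_eq_zero fun y _ => ?_
  have : ∃ e ∈ path y.1, η e y.2 ≠ true := by
    by_contra! hc
    exact h ⟨y, hc⟩
  obtain ⟨e, he, hne⟩ := this
  rw [Finset.prod_eq_zero he (by simp [ind, hne]), mul_zero]

open Classical in
/-- The second moment bound. -/
theorem one_le_mean_hit_mul_energy [Fintype L] {p : ℝ} (hp : 0 < p) {r : T → T → ℝ}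
    {w : E → (T → Bool) → ℝ} (hw : ∀ e, EdgeLaw p r (w e)) (path : L → Finset E)
    {μ : L × T → ℝ} (hμ1 : ∑ x, μ x = 1) :
    1 ≤ mean (prodWeight w) (fun η => if HitSet path η then 1 else 0) *
      ∑ x, ∑ y, μ x * μ y * r x.2 y.2 ^ (path x.1 ∩ path y.1).card := by
  have hW : 0 ≤ prodWeight w := prodWeight_nonneg fun e => (hw e).nonneg
  rw [← EdgeLaw.mean_openMass_sq hp hw]
  have h1 := EdgeLaw.mean_openMass hp hw path μ
  rw [hμ1] at h1
  have h2 : (1 : ℝ) = (∑ η, prodWeight w η * openMass p path μ η) ^ 2 := by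
    change mean _ _ = 1 at h1
    rw [mean] at h1
    rw [h1, one_pow]
  -- Cauchy–Schwarz for `openMass` times the indicator of `HitSet`, off which `openMass` vanishes.
  calc (1 : ℝ) = (∑ η, prodWeight w η * openMass p path μ η) ^ 2 := h2
    _ ≤ _ := by
      unfold mean
      refine Finset.sum_sq_le_sum_mul_sum_of_sq_le_mul _ (fun η _ => ?_) (fun η _ => ?_)
        fun η _ => ?_
      · exact mul_nonneg (hW η) (by dsimp only; split_ifs <;> norm_num)
      · exact mul_nonneg (hW η) (sq_nonneg _)
      · dsimp only
        split_ifs with h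
        · exact le_of_eq (by ring)
        · rw [openMass_eq_zero h]
          simp

/-- The closed quadrants around `i` cover everything; their overlaps only help since `f` is
nonnegative. -/
theorem sum_le_sum_quadrants {ι A B : Type*} [Fintype ι] [LinearOrder A] [LinearOrder B]
    (a : ι → A) (b : ι → B) (i : ι) (f : ι → ℝ) (hf : 0 ≤ f) :
    ∑ j, f j ≤ (∑ j, if a i ≤ a j ∧ b i ≤ b j then f j else 0) +
      (∑ j, if a i ≤ a j ∧ b j ≤ b i then f j else 0) +
      (∑ j, if a j ≤ a i ∧ b i ≤ b j then f j else 0) +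
      ∑ j, if a j ≤ a i ∧ b j ≤ b i then f j else 0 := by
  simp only [← Finset.sum_add_distrib]
  refine Finset.sum_le_sum fun j _ => ?_
  have := hf j
  simp only [Pi.zero_apply] at this
  rcases le_total (a i) (a j) with h1 | h1 <;> rcases le_total (b i) (b j) with h2 | h2 <;>
    simp only [h1, h2, and_self, if_true, true_and, and_true] <;> split_ifs <;> linarith

open Classical in
/-- The hitting estimate: the law of a suitable open pair, given that there is one, has small
energy. -/
theorem exists_energy_le [Fintype L] {A B : Type*} [LinearOrder A] [LinearOrder B] {α : L → A}
    {τ : T → B} {p : ℝ} {r : T → T → ℝ} {w : E → (T → Bool) → ℝ} (hp : 0 < p)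
    (hr : ∀ i j, 0 ≤ r i j) (hw : ∀ e, EdgeLaw p r (w e)) (hm : ∀ e, EdgeMarkov τ p r (w e))
    (hm' : ∀ e, EdgeMarkov (fun i => OrderDual.toDual (τ i)) p r (w e)) {path : L → Finset E}
    (hplanar : ∀ u v w, α u ≤ α v → α v ≤ α w → path u ∩ path w ⊆ path v)
    (hpos : 0 < mean (prodWeight w) (fun η => if HitSet path η then 1 else 0)) :
    ∃ μ : L × T → ℝ, 0 ≤ μ ∧ ∑ x, μ x = 1 ∧
      mean (prodWeight w) (fun η => if HitSet path η then 1 else 0) *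
        ∑ x, ∑ y, μ x * μ y * r x.2 y.2 ^ (path x.1 ∩ path y.1).card ≤ 256 := by
  have hW : 0 ≤ prodWeight w := prodWeight_nonneg fun e => (hw e).nonneg
  set c := mean (prodWeight w) (fun η => if HitSet path η then 1 else 0) with hc
  have hne : Nonempty (L × T) := by
    by_contra hcon
    have : ∀ η : E → T → Bool, ¬ HitSet path η := fun η ⟨x, _⟩ => hcon ⟨x⟩
    rw [hc] at hpos
    simp [this, mean] at hpos
  -- An arbitrary selection of an open pair. The selected point on the complement of `HitSet` is
  -- never used.
  have hsel : ∀ η : E → T → Bool, ∃ x : L × T, HitSet path η → ∀ e ∈ path x.1, η e x.2 = true := by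
    intro η
    by_cases h : HitSet path η
    · obtain ⟨x, hx⟩ := h
      exact ⟨x, fun _ => hx⟩
    · exact ⟨hne.some, fun h' => absurd h' h⟩
  choose sel hsel' using hsel
  -- The law of the selected pair, conditioned on `HitSet`.
  set μ : L × T → ℝ := fun x =>
    c⁻¹ * mean (prodWeight w) (fun η => if HitSet path η ∧ sel η = x then 1 else 0) with hμdef
  have hμ0 : 0 ≤ μ := fun x => mul_nonneg (inv_nonneg.2 hpos.le)
    (mean_nonneg hW fun η _ => by split_ifs <;> norm_num)
  have hμint : ∀ F : L × T → ℝ,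
      c * ∑ x, μ x * F x = mean (prodWeight w) (fun η => if HitSet path η then F (sel η) else 0) := by
    intro F
    have h1 : ∀ η : E → T → Bool, (if HitSet path η then F (sel η) else 0) =
        ∑ x, F x * (if HitSet path η ∧ sel η = x then 1 else 0) := by
      intro η
      by_cases h : HitSet path η <;> simp [h]
    simp only [h1]
    rw [mean_sum, Finset.mul_sum]
    refine Finset.sum_congr rfl fun x _ => ?_
    rw [mean_const_mul]
    simp only [hμdef]
    field_simp
  have hμ1 : ∑ x, μ x = 1 := by
    have := hμint fun _ => 1
    simp only [mul_one] at this
    exact mul_left_cancel₀ hpos.ne' (this.trans (mul_one c).symm)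
  refine ⟨μ, hμ0, hμ1, ?_⟩
  set en := ∑ x, ∑ y, μ x * μ y * r x.2 y.2 ^ (path x.1 ∩ path y.1).card with hen
  have hZ : mean (prodWeight w) (fun η => openMass p path μ η ^ 2) = en :=
    EdgeLaw.mean_openMass_sq hp hw path μ
  -- Betweenness is symmetric under reversal, so the quadrant bound is available for both orders on
  -- `L` and, by `hm` and `hm'`, for both directions of time.
  have hplanar' : ∀ u v w, OrderDual.toDual (α u) ≤ OrderDual.toDual (α v) →
      OrderDual.toDual (α v) ≤ OrderDual.toDual (α w) → path u ∩ path w ⊆ path v := by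
    intro u v w h1 h2
    rw [Finset.inter_comm]
    exact hplanar w v u (OrderDual.toDual_le_toDual.1 h2) (OrderDual.toDual_le_toDual.1 h1)
  obtain ⟨S₁, hS₁, hS₁', hb₁⟩ := exists_quadrant_bound hp hr hw hm hplanar hμ0
  obtain ⟨S₂, hS₂, hS₂', hb₂⟩ := exists_quadrant_bound hp hr hw hm' hplanar hμ0
  obtain ⟨S₃, hS₃, hS₃', hb₃⟩ := exists_quadrant_bound (α := fun v => OrderDual.toDual (α v))
    hp hr hw hm hplanar' hμ0
  obtain ⟨S₄, hS₄, hS₄', hb₄⟩ := exists_quadrant_bound (α := fun v => OrderDual.toDual (α v))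
    hp hr hw hm' hplanar' hμ0
  rw [hZ] at hS₁' hS₂' hS₃' hS₄'
  simp only [OrderDual.toDual_le_toDual] at hb₂ hb₃ hb₄
  set F : L × T → ℝ := fun x => ∑ y : L × T, μ y * r x.2 y.2 ^ (path x.1 ∩ path y.1).card with hF
  have hF0 : 0 ≤ F := fun x => Finset.sum_nonneg fun y _ => mul_nonneg (hμ0 y) (pow_nonneg (hr _ _) _)
  have hFI : en = ∑ x, μ x * F x := by
    simp only [hen, hF, Finset.mul_sum, mul_assoc]
  have hpt : ∀ η, prodWeight w η ≠ 0 → (if HitSet path η then F (sel η) ^ 2 else 0) ≤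
      4 * (S₁ η ^ 2 + S₂ η ^ 2 + S₃ η ^ 2 + S₄ η ^ 2) := by
    intro η hη
    split_ifs with h
    · have h0 := sum_le_sum_quadrants (fun y : L × T => α y.1) (fun y : L × T => τ y.2) (sel η)
        (fun y => μ y * r (sel η).2 y.2 ^ (path (sel η).1 ∩ path y.1).card)
        (fun y => mul_nonneg (hμ0 y) (pow_nonneg (hr _ _) _))
      have h1 := hb₁ η hη _ _ (hsel' η h)
      have h2 := hb₂ η hη _ _ (hsel' η h)
      have h3 := hb₃ η hη _ _ (hsel' η h)
      have h4 := hb₄ η hη _ _ (hsel' η h)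
      have h5 : F (sel η) ≤ S₁ η + S₂ η + S₃ η + S₄ η := by
        simp only [hF]
        linarith
      calc F (sel η) ^ 2 ≤ (S₁ η + S₂ η + S₃ η + S₄ η) ^ 2 := pow_le_pow_left₀ (hF0 _) h5 2
        _ ≤ _ := by
          nlinarith [sq_nonneg (S₁ η - S₂ η), sq_nonneg (S₁ η - S₃ η), sq_nonneg (S₁ η - S₄ η),
            sq_nonneg (S₂ η - S₃ η), sq_nonneg (S₂ η - S₄ η), sq_nonneg (S₃ η - S₄ η)]
    · positivity
  have hbound := mean_mono hW hpt
  rw [← hμint fun x => F x ^ 2, mean_const_mul] at hbound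
  have hadd : mean (prodWeight w) (fun η => S₁ η ^ 2 + S₂ η ^ 2 + S₃ η ^ 2 + S₄ η ^ 2) =
      mean (prodWeight w) (fun η => S₁ η ^ 2) + mean (prodWeight w) (fun η => S₂ η ^ 2) +
        mean (prodWeight w) (fun η => S₃ η ^ 2) + mean (prodWeight w) (fun η => S₄ η ^ 2) := by
    simp only [mean, mul_add, Finset.sum_add_distrib]
  -- The energy is the `μ`-mean of the potential `F`, so Cauchy–Schwarz bounds its square by the
  -- mean of `F ^ 2`.
  have hCS : en ^ 2 ≤ ∑ x, μ x * F x ^ 2 := by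
    have := Finset.sum_sq_le_sum_mul_sum_of_sq_le_mul Finset.univ (r := fun x => μ x * F x)
      (f := μ) (g := fun x => μ x * F x ^ 2) (fun x _ => hμ0 x)
      (fun x _ => mul_nonneg (hμ0 x) (sq_nonneg _)) (fun x _ => le_of_eq (by ring))
    rwa [hμ1, one_mul, ← hFI] at this
  have hI0 : 0 ≤ en := by
    rw [hFI]
    exact Finset.sum_nonneg fun x _ => mul_nonneg (hμ0 x) (hF0 x)
  -- 256 = 4 · 4 · 16: the square of a sum of four terms, the four quadrants, and the two uses of
  -- Doob's inequality.
  have hfin : c * en ^ 2 ≤ 256 * en := by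
    have := mul_le_mul_of_nonneg_left hCS hpos.le
    linarith
  rcases hI0.eq_or_lt with h | h
  · rw [← h]
    norm_num
  · refine le_of_mul_le_mul_right ?_ h
    linarith [hfin, sq en, show c * en * en = c * en ^ 2 by ring]

end FiniteModel

/-! ### The two-state Markov chain of one edge -/

section EdgeProcess

/-- The stationary law of the edge dynamics. -/
def statWeight (p : ℝ) (b : Bool) : ℝ := if b then p else 1 - p

/-- The generator has eigenvalues 0 and -1, because the two rates add up to 1; `U` holds the
eigenvectors as columns. In probabilistic terms, the edge is resampled from the stationary law at
rate 1. -/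
theorem edgeTransition_apply (p t : ℝ) (a b : Bool) :
    edgeTransition p t a b =
      Real.exp (-t) * (if a = b then 1 else 0) + (1 - Real.exp (-t)) * statWeight p b := by
  let U : Matrix Bool Bool ℝ := Matrix.of fun a b => if b then (if a then -(1 - p) else p) else 1
  let V : Matrix Bool Bool ℝ := Matrix.of fun a b =>
    if a then (if b then -1 else 1) else (if b then p else 1 - p)
  have hUV : U * V = 1 := by
    ext a b
    cases a <;> cases b <;> simp [U, V, Matrix.mul_apply]
  have hVU : V * U = 1 := by
    ext a b
    cases a <;> cases b <;> simp [U, V, Matrix.mul_apply]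
    ring
  let W : (Matrix Bool Bool ℝ)ˣ := ⟨U, V, hUV, hVU⟩
  have hQ : t • edgeGenerator p = U * Matrix.diagonal (fun b => if b then -t else 0) * V := by
    ext a b
    cases a <;> cases b <;> simp [U, V, Matrix.mul_apply, Matrix.diagonal_apply, edgeGenerator] <;>
      ring
  have h := Matrix.exp_units_conj W (Matrix.diagonal (fun b : Bool => if b then -t else 0))
  change NormedSpace.exp (U * _ * V) = U * _ * V at h
  rw [edgeTransition, hQ, h, Matrix.exp_diagonal]
  have he : NormedSpace.exp (fun b : Bool => if b then -t else (0 : ℝ)) =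
      fun b => if b then Real.exp (-t) else 1 := by
    ext b
    rw [Pi.coe_exp]
    cases b <;> simp [Real.exp_eq_exp_ℝ]
  rw [he]
  cases a <;> cases b <;>
    simp [U, V, Matrix.mul_apply, Matrix.diagonal_apply, statWeight] <;> ring

theorem bernoulliMeasure_real_singleton (p : I) (b : Bool) :
    (bernoulliMeasure true false p).real {b} = statWeight p b := by
  rw [bernoulliMeasure_real_apply p (by measurability)]
  cases b <;> simp [statWeight]

theorem sum_statWeight_mul_edgeTransition (p t : ℝ) (b : Bool) :
    ∑ a, statWeight p a * edgeTransition p t a b = statWeight p b := by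
  simp only [edgeTransition_apply, Fintype.sum_bool]
  cases b <;> simp [statWeight] <;> ring

/-- Detailed balance. It provides the Markov property backwards in time, which two of the four
quadrants need. -/
theorem statWeight_mul_edgeTransition_comm (p t : ℝ) (a b : Bool) :
    statWeight p a * edgeTransition p t a b = statWeight p b * edgeTransition p t b a := by
  simp only [edgeTransition_apply]
  cases a <;> cases b <;> simp [statWeight] <;> ring

variable {Ω : Type*} [MeasurableSpace Ω] {p : I} {P : Measure Ω} [IsProbabilityMeasure P]
  {Y : ℝ≥0 → Ω → Bool}

theorem IsEdgeProcess.measurableSet (hY : IsEdgeProcess p P Y) (t : ℝ≥0) (b : Bool) :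
    MeasurableSet {ω | Y t ω = b} :=
  hY.measurable t (measurableSet_singleton b)

/-- Finite-dimensional distributions at times that need not start at `0`. -/
theorem IsEdgeProcess.fdd' (hY : IsEdgeProcess p P Y) (n : ℕ) (t : Fin (n + 1) → ℝ≥0)
    (ht : Monotone t) (a : Fin (n + 1) → Bool) :
    P.real {ω | ∀ i, Y (t i) ω = a i} = statWeight p (a 0) *
      ∏ i : Fin n, edgeTransition p ((t i.succ : ℝ) - (t i.castSucc : ℝ))
          (a i.castSucc) (a i.succ) := by
  -- `fdd` requires the first time to be 0; prepend it and sum over the state there, using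
  -- stationarity.
  have hmono : Monotone (Fin.cons 0 t : Fin (n + 2) → ℝ≥0) := by
    intro i j hij
    refine Fin.cases (fun _ => ?_) (fun i hij => ?_) i hij
    · simp
    · obtain ⟨j, rfl⟩ := Fin.exists_succ_eq.2 (fun h : j = 0 => by
        subst h; exact absurd hij (by simp))
      simpa using ht (Fin.succ_le_succ_iff.1 hij)
  have h1 : ∀ b : Bool, P.real {ω | (∀ i, Y (t i) ω = a i) ∧ Y 0 ω = b} =
      (statWeight p b * edgeTransition p (t 0) b (a 0)) *
      ∏ i : Fin n, edgeTransition p ((t i.succ : ℝ) - (t i.castSucc : ℝ))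
          (a i.castSucc) (a i.succ) := by
    intro b
    have := hY.fdd (n + 1) (Fin.cons 0 t) hmono rfl (Fin.cons b a)
    rw [bernoulliMeasure_real_singleton, Fin.prod_univ_succ] at this
    simp only [Fin.cons_zero, Fin.castSucc_zero, Fin.cons_succ, ← Fin.succ_castSucc] at this
    rw [show {ω | (∀ i, Y (t i) ω = a i) ∧ Y 0 ω = b} = {ω | ∀ i : Fin (n + 2),
      Y ((Fin.cons 0 t : Fin (n + 2) → ℝ≥0) i) ω = (Fin.cons b a : Fin (n + 2) → Bool) i} by
        ext ω
        simp [Fin.forall_fin_succ (n := n + 1), and_comm], this]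
    simp [mul_assoc]
  have h2 : P.real {ω | ∀ i, Y (t i) ω = a i} =
      ∑ b : Bool, P.real {ω | (∀ i, Y (t i) ω = a i) ∧ Y 0 ω = b} := by
    rw [Fintype.sum_bool, add_comm (P.real _)]
    have := measureReal_inter_add_sdiff (μ := P) (s := {ω | ∀ i, Y (t i) ω = a i})
      (hY.measurableSet 0 false)
    rw [← this]
    congr 2
    ext ω
    simp
  rw [h2]
  simp only [h1]
  rw [← Finset.sum_mul, sum_statWeight_mul_edgeTransition]

theorem setOf_forall_orderEmbOfFin (s : Finset ℝ≥0) {n : ℕ} (hn : s.card = n)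
    (x : ℝ≥0 → Bool) :
    {ω | ∀ i, Y (s.orderEmbOfFin hn i) ω = x (s.orderEmbOfFin hn i)} =
      {ω | ∀ i ∈ s, Y i ω = x i} := by
  ext ω
  have := Finset.range_orderEmbOfFin s hn
  simp only [Set.mem_ofPred_eq]
  constructor
  · intro h i hi
    have : i ∈ Set.range (s.orderEmbOfFin hn) := by rw [this]; exact hi
    obtain ⟨j, rfl⟩ := this
    exact h j
  · exact fun h i => h _ (s.orderEmbOfFin_mem hn i)

theorem IsEdgeProcess.markov_future (hY : IsEdgeProcess p P Y) {s : Finset ℝ≥0} {k j : ℝ≥0}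
    (hk : k ∈ s) (hs : ∀ i ∈ s, i ≤ k) (hkj : k ≤ j) (x : ℝ≥0 → Bool) (b : Bool) :
    P.real {ω | (∀ i ∈ s, Y i ω = x i) ∧ Y j ω = b} =
      P.real {ω | ∀ i ∈ s, Y i ω = x i} * edgeTransition p ((j : ℝ) - k) (x k) b := by
  obtain ⟨n, hn⟩ := Nat.exists_eq_succ_of_ne_zero (Finset.card_ne_zero_of_mem hk)
  set t := s.orderEmbOfFin hn with ht
  have hlast : t (Fin.last n) = k := by
    refine le_antisymm (hs _ (s.orderEmbOfFin_mem hn _)) ?_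
    have : k ∈ Set.range t := by rw [Finset.range_orderEmbOfFin s hn]; exact hk
    obtain ⟨i, rfl⟩ := this
    exact t.monotone (Fin.le_last i)
  have h1 := hY.fdd' n t t.monotone (fun i => x (t i))
  rw [setOf_forall_orderEmbOfFin s hn x] at h1
  have hmono : Monotone (Fin.snoc t j : Fin (n + 2) → ℝ≥0) := by
    intro i i' hii
    refine Fin.lastCases (fun hii => ?_) (fun i' hii => ?_) i' hii
    · rw [Fin.snoc_last]
      refine Fin.lastCases ?_ (fun i => ?_) i
      · simp
      · rw [Fin.snoc_castSucc]
        exact (hs _ (s.orderEmbOfFin_mem hn _)).trans hkj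
    · have hlt : i < Fin.last (n + 1) := lt_of_le_of_lt hii (Fin.castSucc_lt_last i')
      obtain ⟨i, rfl⟩ := Fin.exists_castSucc_eq.2 hlt.ne
      simpa using t.monotone (Fin.castSucc_le_castSucc_iff.1 hii)
  have h2 := hY.fdd' (n + 1) (Fin.snoc t j) hmono (Fin.snoc (fun i => x (t i)) b)
  rw [Fin.prod_univ_castSucc] at h2
  simp only [Fin.snoc_castSucc, Fin.succ_last, Fin.snoc_last, Fin.succ_castSucc, hlast] at h2
  have hset : {ω | (∀ i ∈ s, Y i ω = x i) ∧ Y j ω = b} = {ω | ∀ i : Fin (n + 2),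
      Y ((Fin.snoc t j : Fin (n + 2) → ℝ≥0) i) ω =
        (Fin.snoc (fun i => x (t i)) b : Fin (n + 2) → Bool) i} := by
    rw [Set.ofPred_and, ← setOf_forall_orderEmbOfFin s hn x]
    ext ω
    simp [Fin.forall_fin_succ' (n := n + 1), ← ht]
  rw [hset, h2, h1]
  have : (Fin.snoc (fun i => x (t i)) b : Fin (n + 2) → Bool) 0 = x (t 0) := by
    rw [← Fin.castSucc_zero, Fin.snoc_castSucc]
  rw [this, mul_assoc]

/-- An earlier time is prepended to the chain; detailed balance then turns the new initial factor
into a transition out of the state at `k`. -/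
theorem IsEdgeProcess.markov_past (hY : IsEdgeProcess p P Y) {s : Finset ℝ≥0} {k j : ℝ≥0}
    (hk : k ∈ s) (hs : ∀ i ∈ s, k ≤ i) (hkj : j ≤ k) (x : ℝ≥0 → Bool) (b : Bool) :
    P.real {ω | (∀ i ∈ s, Y i ω = x i) ∧ Y j ω = b} =
      P.real {ω | ∀ i ∈ s, Y i ω = x i} * edgeTransition p ((k : ℝ) - j) (x k) b := by
  obtain ⟨n, hn⟩ := Nat.exists_eq_succ_of_ne_zero (Finset.card_ne_zero_of_mem hk)
  set t := s.orderEmbOfFin hn with ht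
  have hfirst : t 0 = k := by
    refine le_antisymm ?_ (hs _ (s.orderEmbOfFin_mem hn _))
    have : k ∈ Set.range t := by rw [Finset.range_orderEmbOfFin s hn]; exact hk
    obtain ⟨i, rfl⟩ := this
    exact t.monotone (Fin.zero_le i)
  have h1 := hY.fdd' n t t.monotone (fun i => x (t i))
  rw [setOf_forall_orderEmbOfFin s hn x] at h1
  have hmono : Monotone (Fin.cons j t : Fin (n + 2) → ℝ≥0) := by
    intro i i' hii
    refine Fin.cases (fun hii => ?_) (fun i hii => ?_) i hii
    · rw [Fin.cons_zero]
      refine Fin.cases ?_ (fun i => ?_) i'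
      · simp
      · rw [Fin.cons_succ]
        exact hkj.trans (hs _ (s.orderEmbOfFin_mem hn _))
    · obtain ⟨i', rfl⟩ := Fin.exists_succ_eq.2 (fun h : i' = 0 => by
        subst h; exact absurd hii (by simp))
      simpa using t.monotone (Fin.succ_le_succ_iff.1 hii)
  have h2 := hY.fdd' (n + 1) (Fin.cons j t) hmono (Fin.cons b (fun i => x (t i)))
  rw [Fin.prod_univ_succ] at h2
  simp only [Fin.cons_zero, Fin.castSucc_zero, Fin.cons_succ, ← Fin.succ_castSucc, hfirst] at h2
  have hset : {ω | (∀ i ∈ s, Y i ω = x i) ∧ Y j ω = b} = {ω | ∀ i : Fin (n + 2),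
      Y ((Fin.cons j t : Fin (n + 2) → ℝ≥0) i) ω =
        (Fin.cons b (fun i => x (t i)) : Fin (n + 2) → Bool) i} := by
    rw [Set.ofPred_and, ← setOf_forall_orderEmbOfFin s hn x]
    ext ω
    simp [Fin.forall_fin_succ (n := n + 1), ← ht, and_comm]
  rw [hset, h2, h1, hfirst, ← mul_assoc, statWeight_mul_edgeTransition_comm]
  ring

theorem IsEdgeProcess.real_eq (hY : IsEdgeProcess p P Y) (t : ℝ≥0) (b : Bool) :
    P.real {ω | Y t ω = b} = statWeight p b := by
  have := hY.fdd' 0 (fun _ => t) monotone_const (fun _ => b)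
  simpa using this

theorem IsEdgeProcess.real_eq_and_eq (hY : IsEdgeProcess p P Y) {s t : ℝ≥0} (hst : s ≤ t)
    (a b : Bool) :
    P.real {ω | Y s ω = a ∧ Y t ω = b} =
      statWeight p a * edgeTransition p ((t : ℝ) - s) a b := by
  have := hY.markov_future (s := {s}) (k := s) (by simp) (by simp) hst (fun _ => a) b
  simpa [hY.real_eq] using this

/-- The factor `1 + (q / p) exp(-|s - t|)` of the kernel. -/
noncomputable def rate (p : ℝ) (s t : ℝ≥0) : ℝ :=
  1 + (1 - p) / p * Real.exp (-|(s : ℝ) - (t : ℝ)|)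

theorem one_le_rate (p : I) (s t : ℝ≥0) : 1 ≤ rate p s t := by
  unfold rate
  have h1 : 0 ≤ 1 - (p : ℝ) := by linarith [p.2.2]
  have := div_nonneg h1 p.2.1
  have := mul_nonneg this (Real.exp_pos (-|(s : ℝ) - (t : ℝ)|)).le
  linarith

theorem rate_comm (p : ℝ) (s t : ℝ≥0) : rate p s t = rate p t s := by
  unfold rate
  rw [abs_sub_comm]

/-- This is where the base of the kernel h comes from: `rate` is the factor by which being open at
time s raises the probability of being open at time t. -/
theorem edgeTransition_true_true {p : ℝ} (hp : 0 < p) {s t : ℝ≥0} (hst : s ≤ t) :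
    edgeTransition p ((t : ℝ) - s) true true = p * rate p s t := by
  have h : |(s : ℝ) - t| = t - s := by
    rw [abs_sub_comm, abs_of_nonneg (sub_nonneg.2 (NNReal.coe_le_coe.2 hst))]
  rw [edgeTransition_apply, rate, h]
  simp only [statWeight, if_true]
  field_simp
  ring

/-- The weights on `S → Bool` of the edge process observed at the finite set of times `S`. -/
noncomputable def edgeWeight (P : Measure Ω) (Y : ℝ≥0 → Ω → Bool) (S : Finset ℝ≥0) (x : S → Bool) :
    ℝ :=
  P.real {ω | ∀ t : S, Y t ω = x t}

theorem IsEdgeProcess.sum_edgeWeight (hY : IsEdgeProcess p P Y) (S : Finset ℝ≥0)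
    (q : (S → Bool) → Prop) [DecidablePred q] :
    ∑ x with q x, edgeWeight P Y S x = P.real {ω | q fun t => Y t ω} := by
  classical
  have hmeas : ∀ x : S → Bool, MeasurableSet {ω | ∀ t : S, Y t ω = x t} := fun x => by
    rw [Set.ofPred_forall]
    exact MeasurableSet.iInter fun t => hY.measurableSet t (x t)
  unfold edgeWeight
  rw [← measureReal_biUnion_finset (fun x _ y _ hxy => ?_) (fun x _ => hmeas x)]
  · congr 1
    ext ω
    simp only [Set.mem_iUnion, Finset.mem_filter, Finset.mem_univ, true_and, Set.mem_ofPred_eq,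
      exists_prop]
    constructor
    · rintro ⟨x, hq, hx⟩
      rwa [show (fun t : S => Y t ω) = x from funext hx]
    · exact fun h => ⟨_, h, fun _ => rfl⟩
  · refine Set.disjoint_left.2 fun ω h1 h2 => hxy (funext fun t => ?_)
    exact (h1 t).symm.trans (h2 t)

theorem IsEdgeProcess.sum_edgeWeight_mul_ind (hY : IsEdgeProcess p P Y) (S : Finset ℝ≥0)
    (q : (S → Bool) → Prop) [DecidablePred q] (j : S) :
    ∑ x with q x, edgeWeight P Y S x * ind (x j) =
      P.real {ω | q (fun t => Y t ω) ∧ Y j ω = true} := by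
  rw [← hY.sum_edgeWeight S fun x => q x ∧ x j = true]
  simp only [ind, mul_ite, mul_one, mul_zero]
  rw [← Finset.sum_filter, Finset.filter_filter]

theorem IsEdgeProcess.edgeLaw (hY : IsEdgeProcess p P Y) (hp : 0 < (p : ℝ)) (S : Finset ℝ≥0) :
    EdgeLaw p (fun i j : S => rate p i j) (edgeWeight P Y S) where
  nonneg x := measureReal_nonneg
  total := by
    have := hY.sum_edgeWeight S fun _ => True
    simpa [mean] using this
  one j := by
    have := hY.sum_edgeWeight_mul_ind S (fun _ => True) j
    simpa [mean, hY.real_eq, statWeight] using this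
  two i j := by
    have key : ∀ i j : S, i ≤ j → mean (edgeWeight P Y S) (fun x => ind (x i) * ind (x j)) =
        (p : ℝ) ^ 2 * rate p i j := by
      intro i j hij
      have h1 := hY.sum_edgeWeight_mul_ind S (fun x => x i = true) j
      rw [hY.real_eq_and_eq hij, edgeTransition_true_true hp hij, Finset.sum_filter] at h1
      rw [mean, sq, mul_assoc]
      refine Eq.trans (Finset.sum_congr rfl fun x _ => ?_) h1
      by_cases h : x i = true <;> simp [ind, h]
    rcases le_total i j with h | h
    · exact key i j h
    · rw [rate_comm, ← key j i h]
      simp only [mul_comm]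

theorem IsEdgeProcess.edgeMarkov (hY : IsEdgeProcess p P Y) (hp : 0 < (p : ℝ)) (S : Finset ℝ≥0) :
    EdgeMarkov (fun i : S => (i : ℝ≥0)) p (fun i j : S => rate p i j) (edgeWeight P Y S) := by
  classical
  intro k j hkj x hx
  rw [hY.sum_edgeWeight S, hY.sum_edgeWeight_mul_ind S]
  -- The value `true` off `S` is never read, since only times in `S` occur.
  have h := hY.markov_future (s := S.filter (· ≤ k)) (k := k) (by simp) (by simp) hkj
    (fun t => if h : t ∈ S then x ⟨t, h⟩ else true) true
  have hset : {ω | ∀ i ∈ S.filter (· ≤ (k : ℝ≥0)), Y i ω = if h : i ∈ S then x ⟨i, h⟩ else true} =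
      {ω | ∀ i : S, (i : ℝ≥0) ≤ k → x i = Y i ω} := by
    ext ω
    simp only [Set.mem_ofPred_eq, Finset.mem_filter, and_imp, Subtype.forall]
    refine forall_congr' fun i => forall_congr' fun hi => forall_congr' fun _ => ?_
    rw [dif_pos hi, eq_comm]
  rw [Set.ofPred_and, hset, ← Set.ofPred_and] at h
  rw [h]
  simp only [Finset.coe_mem, dite_true, Subtype.coe_eta, hx, edgeTransition_true_true hp hkj]
  rw [mul_comm]

theorem IsEdgeProcess.edgeMarkov_dual (hY : IsEdgeProcess p P Y) (hp : 0 < (p : ℝ))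
    (S : Finset ℝ≥0) :
    EdgeMarkov (fun i : S => OrderDual.toDual (i : ℝ≥0)) p (fun i j : S => rate p i j)
      (edgeWeight P Y S) := by
  classical
  intro k j hkj x hx
  simp only [OrderDual.toDual_le_toDual] at hkj ⊢
  rw [hY.sum_edgeWeight S, hY.sum_edgeWeight_mul_ind S]
  have h := hY.markov_past (s := S.filter (k ≤ ·)) (k := k) (by simp) (by simp) hkj
    (fun t => if h : t ∈ S then x ⟨t, h⟩ else true) true
  have hset : {ω | ∀ i ∈ S.filter ((k : ℝ≥0) ≤ ·), Y i ω = if h : i ∈ S then x ⟨i, h⟩ else true} =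
      {ω | ∀ i : S, (k : ℝ≥0) ≤ i → x i = Y i ω} := by
    ext ω
    simp only [Set.mem_ofPred_eq, Finset.mem_filter, and_imp, Subtype.forall]
    refine forall_congr' fun i => forall_congr' fun hi => forall_congr' fun _ => ?_
    rw [dif_pos hi, eq_comm]
  rw [Set.ofPred_and, hset, ← Set.ofPred_and] at h
  rw [h]
  simp only [Finset.coe_mem, dite_true, Subtype.coe_eta, hx, edgeTransition_true_true hp hkj]
  rw [mul_comm, rate_comm]

end EdgeProcess

/-! ### Rays, compactness of the boundary, and Kőnig's lemma -/

section RayGeometry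

variable {V : Type*} {G : SimpleGraph V} {ρ : V}

/-- The `k`-th edge of a ray. -/
def Ray.edge (v : Ray G ρ) (k : ℕ) : G.edgeSet :=
  ⟨s(v.toFun k, v.toFun (k + 1)), v.adj k⟩

/-- The initial segment of a sequence of adjacent vertices, as a walk. -/
def prefixWalk (f : ℕ → V) (h : ∀ n, G.Adj (f n) (f (n + 1))) : ∀ n, G.Walk (f 0) (f n)
  | 0 => .nil
  | n + 1 => (prefixWalk f h n).concat (h n)

theorem length_prefixWalk (f : ℕ → V) (h : ∀ n, G.Adj (f n) (f (n + 1))) (n : ℕ) :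
    (prefixWalk f h n).length = n := by
  induction n with
  | zero => rfl
  | succ n ih => rw [prefixWalk, SimpleGraph.Walk.length_concat, ih]

theorem support_prefixWalk (f : ℕ → V) (h : ∀ n, G.Adj (f n) (f (n + 1))) (n : ℕ) :
    (prefixWalk f h n).support = (List.range (n + 1)).map f := by
  induction n with
  | zero => rfl
  | succ n ih =>
    rw [prefixWalk, SimpleGraph.Walk.support_concat, ih, List.range_succ (n := n + 1),
      List.map_append]
    rfl

/-- Both initial segments are paths from the root to the same vertex, and in an acyclic graph such a
path is unique; compare lengths and supports. -/
theorem Ray.eq_of_apply_eq (hG : G.IsAcyclic) (v w : Ray G ρ) {j k : ℕ}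
    (h : v.toFun j = w.toFun k) : j = k ∧ ∀ i ≤ k, v.toFun i = w.toFun i := by
  have key : ∀ (v : Ray G ρ) n, (prefixWalk v.toFun v.adj n).IsPath := fun v n => by
    rw [SimpleGraph.Walk.isPath_def, support_prefixWalk]
    exact List.nodup_range.map v.inj
  let a : G.Path ρ (w.toFun k) :=
    ⟨(prefixWalk v.toFun v.adj j).copy v.start h, by simpa using key v j⟩
  let b : G.Path ρ (w.toFun k) :=
    ⟨(prefixWalk w.toFun w.adj k).copy w.start rfl, by simpa using key w k⟩
  have hab : a.1 = b.1 := congrArg Subtype.val ((hG.subsingleton_path _ _).elim a b)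
  have hl := congrArg SimpleGraph.Walk.length hab
  simp only [a, b, SimpleGraph.Walk.length_copy, length_prefixWalk] at hl
  refine ⟨hl, fun i hi => ?_⟩
  have hs := congrArg SimpleGraph.Walk.support hab
  simp only [a, b, SimpleGraph.Walk.support_copy, support_prefixWalk, hl] at hs
  exact List.map_inj_left.1 hs i (List.mem_range.2 (by omega))

theorem Ray.edge_eq_edge (hG : G.IsAcyclic) {v w : Ray G ρ} {j k : ℕ} (h : v.edge j = w.edge k) :
    j = k ∧ ∀ i ≤ k + 1, v.toFun i = w.toFun i := by
  have h' := congrArg Subtype.val h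
  rcases Sym2.eq_iff.1 h' with ⟨h1, h2⟩ | ⟨h1, h2⟩
  · exact ⟨(Ray.eq_of_apply_eq hG v w h1).1, (Ray.eq_of_apply_eq hG v w h2).2⟩
  -- Opposite orientations would give j = k + 1 and j + 1 = k.
  · have := (Ray.eq_of_apply_eq hG v w h1).1
    have := (Ray.eq_of_apply_eq hG v w h2).1
    omega

theorem Ray.edge_congr {v w : Ray G ρ} {k : ℕ} (h : ∀ i ≤ k + 1, v.toFun i = w.toFun i) :
    v.edge k = w.edge k := by
  apply Subtype.ext
  simp only [Ray.edge, h k (by omega), h (k + 1) le_rfl]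

theorem Ray.edge_injective (hG : G.IsAcyclic) (v : Ray G ρ) : Function.Injective v.edge :=
  fun _ _ h => (Ray.edge_eq_edge hG h).1

/-- The vertices that can be reached from `ρ` in exactly `n` steps. -/
def sphere (G : SimpleGraph V) (ρ : V) : ℕ → Set V
  | 0 => {ρ}
  | n + 1 => ⋃ v ∈ sphere G ρ n, G.neighborSet v

theorem finite_sphere [G.LocallyFinite] (n : ℕ) : (sphere G ρ n).Finite := by
  induction n with
  | zero => exact Set.finite_singleton ρ
  | succ n ih => exact ih.biUnion fun v _ => Set.toFinite _

theorem mem_sphere_succ {n : ℕ} {u v : V} (hu : u ∈ sphere G ρ n) (h : G.Adj u v) :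
    v ∈ sphere G ρ (n + 1) :=
  Set.mem_biUnion hu h

theorem Ray.mem_sphere (v : Ray G ρ) (n : ℕ) : v.toFun n ∈ sphere G ρ n := by
  induction n with
  | zero => exact v.start
  | succ n ih => exact mem_sphere_succ ih (v.adj n)

theorem getVert_mem_sphere {H : SimpleGraph V} (hH : H ≤ G) {v : V} (q : H.Walk ρ v) {n : ℕ}
    (hn : n ≤ q.length) : q.getVert n ∈ sphere G ρ n := by
  induction n with
  | zero => exact q.getVert_zero
  | succ n ih => exact mem_sphere_succ (ih (by omega)) (hH (q.adj_getVert_succ (by omega)))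

theorem rayDist_le_iff (v w : Ray G ρ) (n : ℕ) :
    dist v w ≤ Real.exp (-n) ↔ ∀ k ≤ n, v.toFun k = w.toFun k := by
  rw [← le_meetHeight_iff]
  change rayDist v w ≤ _ ↔ _
  unfold rayDist
  split_ifs with h
  · simp [h, (Real.exp_pos _).le]
  · rw [Real.exp_le_exp, neg_le_neg_iff, Nat.cast_le]
    conv_rhs => rw [← ENat.natCast_toNat h]
    rw [Nat.cast_le]

theorem Ray.nhds_hasBasis (v : Ray G ρ) :
    (𝓝 v).HasBasis (fun _ : ℕ => True) fun n => {w | ∀ k ≤ n, v.toFun k = w.toFun k} := by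
  refine Metric.nhds_basis_closedBall.to_hasBasis (fun ε hε => ?_) fun n _ =>
    ⟨Real.exp (-n), Real.exp_pos _, fun w hw => ?_⟩
  · have : Tendsto (fun n : ℕ => Real.exp (-n)) atTop (𝓝 0) :=
      Real.tendsto_exp_neg_atTop_nhds_zero.comp tendsto_natCast_atTop_atTop
    obtain ⟨n, hn⟩ := (this.eventually (gt_mem_nhds hε)).exists
    refine ⟨n, trivial, fun w hw => ?_⟩
    rw [Metric.mem_closedBall, dist_comm]
    exact ((rayDist_le_iff v w n).2 hw).trans hn.le
  · rw [Metric.mem_closedBall, dist_comm] at hw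
    exact (rayDist_le_iff v w n).1 hw

theorem Ray.isLocallyConstant_apply (k : ℕ) :
    IsLocallyConstant fun v : Ray G ρ => v.toFun k := by
  rw [IsLocallyConstant.iff_eventually_eq]
  intro v
  filter_upwards [v.nhds_hasBasis.mem_of_mem (i := k) trivial] with w hw
  exact (hw k le_rfl).symm

/-- With `V` discrete, the ray metric induces the topology of pointwise convergence. Rays form a
closed subset of the product of the spheres, which are finite by local finiteness: each defining
condition involves at most two coordinates. -/
instance Ray.compactSpace [G.LocallyFinite] : CompactSpace (Ray G ρ) := by
  let _ : TopologicalSpace V := ⊥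
  have : DiscreteTopology V := ⟨rfl⟩
  have hind : IsInducing (Ray.toFun : Ray G ρ → ℕ → V) := by
    rw [isInducing_iff_nhds]
    intro v
    refine le_antisymm ?_ ?_
    · refine map_le_iff_le_comap.1 ?_
      exact (continuous_pi fun k => (Ray.isLocallyConstant_apply k).continuous).continuousAt
    · intro s hs
      obtain ⟨n, -, hn⟩ := v.nhds_hasBasis.mem_iff.1 hs
      refine ⟨{g | ∀ k ≤ n, v.toFun k = g k}, ?_, fun w hw => hn hw⟩
      refine IsOpen.mem_nhds ?_ fun k _ => rfl
      have : {g : ℕ → V | ∀ k ≤ n, v.toFun k = g k} =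
          ⋂ k ∈ Set.Iic n, (fun g : ℕ → V => g k) ⁻¹' {v.toFun k} := by
        ext g
        simp [eq_comm]
      rw [this]
      exact (Set.finite_Iic n).isOpen_biInter fun k _ =>
        (isOpen_discrete _).preimage (continuous_apply k)
  rw [← isCompact_univ_iff, hind.isCompact_iff, Set.image_univ]
  have hpi : IsCompact (Set.univ.pi (sphere G ρ)) :=
    isCompact_univ_pi fun n => (finite_sphere n).isCompact
  refine hpi.of_isClosed_subset ?_ ?_
  · have : Set.range (Ray.toFun : Ray G ρ → ℕ → V) =
        (⋂ (_ : Unit), (fun g : ℕ → V => g 0) ⁻¹' {ρ}) ∩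
        (⋂ n, (fun g : ℕ → V => (g n, g (n + 1))) ⁻¹' {x | G.Adj x.1 x.2}) ∩
        ⋂ x : {x : ℕ × ℕ // x.1 ≠ x.2}, (fun g : ℕ → V => (g x.1.1, g x.1.2)) ⁻¹' {y | y.1 ≠ y.2} := by
      ext g
      simp only [Set.mem_range, Set.mem_inter_iff, Set.mem_iInter, Set.mem_preimage]
      constructor
      · rintro ⟨v, rfl⟩
        exact ⟨⟨fun _ => v.start, v.adj⟩, fun x h => x.2 (v.inj h)⟩
      · rintro ⟨⟨h1, h2⟩, h3⟩
        exact ⟨⟨g, h1 (), h2, fun i j hij => by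
          by_contra hne
          exact h3 ⟨(i, j), hne⟩ hij⟩, rfl⟩
    rw [this]
    refine (IsClosed.inter (isClosed_iInter fun _ => ?_) (isClosed_iInter fun n => ?_)).inter
      (isClosed_iInter fun x => ?_)
    · exact (isClosed_discrete _).preimage (continuous_apply 0)
    · exact (isClosed_discrete _).preimage (by fun_prop)
    · exact (isClosed_discrete _).preimage (by fun_prop)
  · rintro _ ⟨v, rfl⟩ n _
    exact v.mem_sphere n

/-- Some ray has its first `n` edges open. -/
def OpenTo (G : SimpleGraph V) (ρ : V) (n : ℕ) (η : G.edgeSet → Bool) : Prop :=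
  ∃ v : Ray G ρ, ∀ k < n, η (v.edge k) = true

theorem OpenTo.anti {m n : ℕ} (hmn : m ≤ n) {η : G.edgeSet → Bool} (h : OpenTo G ρ n η) :
    OpenTo G ρ m η := by
  obtain ⟨v, hv⟩ := h
  exact ⟨v, fun k hk => hv k (hk.trans_le hmn)⟩

/-- Self-avoiding walks of length `n` from `ρ`. -/
abbrev PathSeg (G : SimpleGraph V) (ρ : V) (n : ℕ) : Type _ :=
  {f : Fin (n + 1) → V // f 0 = ρ ∧ (∀ i : Fin n, G.Adj (f i.castSucc) (f i.succ)) ∧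
    Function.Injective f}

theorem PathSeg.finite [G.LocallyFinite] {H : SimpleGraph V} (hH : H ≤ G) (n : ℕ) :
    Finite (PathSeg H ρ n) := by
  have h : ∀ f : PathSeg H ρ n, ∀ i : Fin (n + 1), f.1 i ∈ sphere G ρ i := by
    intro f i
    induction i using Fin.induction with
    | zero => exact f.2.1
    | succ i ih => exact mem_sphere_succ ih (hH (f.2.2.1 i))
  have : (Set.univ.pi fun i : Fin (n + 1) => sphere G ρ i).Finite :=
    Set.Finite.pi fun i => finite_sphere (i : ℕ)
  exact Set.Finite.to_subtype (this.subset fun f hf i _ => h ⟨f, hf⟩ i)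

/-- Kőnig's lemma for the open cluster. -/
theorem Percolates.exists_ray [G.LocallyFinite] {η : G.edgeSet → Bool} (h : Percolates G ρ η) :
    ∃ v : Ray G ρ, ∀ k, η (v.edge k) = true := by
  set H := openGraph G η with hHdef
  have hH : H ≤ G := fun u v huv => huv.1
  have hfin : ∀ n, Finite (PathSeg H ρ n) := PathSeg.finite hH
  -- The infinite cluster has a vertex outside the finitely many vertices reachable in fewer than
  -- `n` steps; an open path to it has length at least `n` and can be cut there.
  have hne : ∀ n, Nonempty (PathSeg H ρ n) := by
    intro n
    have : (⋃ k ∈ Set.Iio n, sphere G ρ k).Finite :=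
      (Set.finite_Iio n).biUnion fun k _ => finite_sphere k
    obtain ⟨v, hv, hvn⟩ := h.exists_notMem_finite this
    obtain ⟨q, hq⟩ := SimpleGraph.Reachable.exists_isPath hv
    have hlen : n ≤ q.length := by
      by_contra hlt
      refine hvn (Set.mem_biUnion (not_le.1 hlt) ?_)
      have := getVert_mem_sphere hH q le_rfl
      rwa [q.getVert_length] at this
    refine ⟨⟨fun i => q.getVert i, q.getVert_zero, fun i => ?_, fun i j hij => ?_⟩⟩
    · exact q.adj_getVert_succ (by simp; omega)
    · exact Fin.ext (hq.getVert_injOn (by simp; omega) (by simp; omega) hij)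
  have := hfin 0
  -- Restriction to initial segments is an inverse system of nonempty finite sets, so a coherent
  -- sequence exists.
  obtain ⟨f, hf⟩ := exists_seq_forall_proj_of_forall_finite (α := fun n => PathSeg H ρ n)
    (fun {i j} hij g => ⟨fun k => g.1 (Fin.castLE (Nat.succ_le_succ hij) k), g.2.1, fun k =>
      g.2.2.1 (Fin.castLE hij k), g.2.2.2.comp (Fin.castLE_injective (Nat.succ_le_succ hij))⟩)
    (fun i a => rfl) (fun i j k hij hjk a => rfl)
    (fun i a => have := hfin (i + 1); Set.toFinite _)
  have hval : ∀ i j (hij : i ≤ j), (f i).1 (Fin.last i) = (f j).1 ⟨i, by omega⟩ := by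
    intro i j hij
    rw [← hf hij]
    rfl
  have hadj : ∀ n, H.Adj ((f n).1 (Fin.last n)) ((f (n + 1)).1 (Fin.last (n + 1))) := by
    intro n
    rw [hval n (n + 1) (by omega)]
    exact (f (n + 1)).2.2.1 (Fin.last n)
  refine ⟨⟨fun n => (f n).1 (Fin.last n), (f 0).2.1, fun n => hH (hadj n), fun i j hij => ?_⟩,
    fun k => (hadj k).2⟩
  simp only [hval i (max i j) (le_max_left _ _), hval j (max i j) (le_max_right _ _)] at hij
  simpa using (f (max i j)).2.2.2 hij

/-- The ray may vary with n. A cluster with N vertices cannot contain the N + 1 distinct vertices at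
the start of a ray whose first N edges are open. -/
theorem percolates_iff [G.LocallyFinite] {η : G.edgeSet → Bool} :
    Percolates G ρ η ↔ ∀ n, OpenTo G ρ n η := by
  classical
  constructor
  · intro h n
    obtain ⟨v, hv⟩ := h.exists_ray
    exact ⟨v, fun k _ => hv k⟩
  · intro h
    by_contra hfin
    rw [Percolates, Set.not_infinite] at hfin
    obtain ⟨v, hv⟩ := h hfin.toFinset.card
    have hreach : ∀ k ≤ hfin.toFinset.card, (openGraph G η).Reachable ρ (v.toFun k) := by
      intro k
      induction k with
      | zero =>
        intro _
        rw [v.start]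
      | succ k ih =>
        intro hk
        have hadj : (openGraph G η).Adj (v.toFun k) (v.toFun (k + 1)) :=
          ⟨v.adj k, hv k (by omega)⟩
        exact (ih (by omega)).trans hadj.reachable
    have hsub : (Finset.range (hfin.toFinset.card + 1)).image v.toFun ⊆ hfin.toFinset := by
      intro x hx
      obtain ⟨k, hk, rfl⟩ := Finset.mem_image.1 hx
      exact hfin.mem_toFinset.2 (hreach k (by have := Finset.mem_range.1 hk; omega))
    have := Finset.card_le_card hsub
    rw [Finset.card_image_of_injective _ v.inj, Finset.card_range] at this
    omega

end RayGeometry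

universe u

/-! ### Vertices of level n and their planar order -/

section Levels

variable {V : Type*} {G : SimpleGraph V} {ρ : V}

/-- The height of the meet of two rays, truncated at level `n`. -/
noncomputable def meetNat (n : ℕ) (v w : Ray G ρ) : ℕ :=
  (min (n : ℕ∞) (meetHeight v w)).toNat

theorem natCast_meetNat (n : ℕ) (v w : Ray G ρ) :
    (meetNat n v w : ℕ∞) = min (n : ℕ∞) (meetHeight v w) :=
  ENat.natCast_toNat (ne_top_of_le_ne_top (ENat.natCast_ne_top n) (min_le_left _ _))

theorem lt_meetNat_iff {n k : ℕ} {v w : Ray G ρ} :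
    k < meetNat n v w ↔ k < n ∧ ∀ i ≤ k + 1, v.toFun i = w.toFun i := by
  rw [← le_meetHeight_iff, ← Nat.succ_le_iff, ← Nat.cast_le (α := ℕ∞), natCast_meetNat, le_min_iff,
    Nat.cast_le, Nat.succ_le_iff, Nat.succ_eq_add_one]

/-- The vertices at distance `n` from the root that lie on rays, encoded by the path to them. -/
abbrev Level (G : SimpleGraph V) (ρ : V) (n : ℕ) : Type _ :=
  Set.range fun (v : Ray G ρ) (i : Fin (n + 1)) => v.toFun i

instance Level.finite [G.LocallyFinite] (n : ℕ) : Finite (Level G ρ n) := by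
  have : (Set.univ.pi fun i : Fin (n + 1) => sphere G ρ i).Finite :=
    Set.Finite.pi fun i => finite_sphere (i : ℕ)
  refine Set.Finite.to_subtype (this.subset ?_)
  rintro _ ⟨v, rfl⟩ i _
  exact v.mem_sphere i

noncomputable instance Level.fintype [G.LocallyFinite] (n : ℕ) : Fintype (Level G ρ n) :=
  Fintype.ofFinite _

/-- The vertex of a ray at level `n`. -/
def Ray.level (n : ℕ) (v : Ray G ρ) : Level G ρ n := ⟨_, v, rfl⟩

/-- A ray through a given vertex. -/
noncomputable def Level.rep {n : ℕ} (u : Level G ρ n) : Ray G ρ := u.2.choose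

theorem Level.rep_apply {n : ℕ} (u : Level G ρ n) {i : ℕ} (hi : i < n + 1) :
    u.rep.toFun i = u.1 ⟨i, hi⟩ :=
  congrFun u.2.choose_spec ⟨i, hi⟩

theorem Ray.rep_level (v : Ray G ρ) {n i : ℕ} (hi : i ≤ n) :
    (v.level n).rep.toFun i = v.toFun i :=
  Level.rep_apply _ (Nat.lt_succ_of_le hi)

theorem meetNat_rep_level (n : ℕ) (v w : Ray G ρ) :
    meetNat n (v.level n).rep (w.level n).rep = meetNat n v w := by
  refine eq_of_forall_lt_iff fun k => ?_
  rw [lt_meetNat_iff, lt_meetNat_iff]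
  refine and_congr_right fun hk => forall_congr' fun i => forall_congr' fun hi => ?_
  rw [v.rep_level (by omega), w.rep_level (by omega)]

open Classical in
/-- The edges on the path from the root to a vertex. -/
noncomputable def Level.edges {n : ℕ} (u : Level G ρ n) : Finset G.edgeSet :=
  (Finset.range n).image u.rep.edge

theorem Level.mem_edges {n : ℕ} {u : Level G ρ n} {e : G.edgeSet} :
    e ∈ u.edges ↔ ∃ k < n, u.rep.edge k = e := by
  simp [Level.edges]

-- Edges shared by two paths from the root form a common initial segment. This turns the exponent of
-- the finite model into the truncated meet height.
open Classical in
theorem Level.card_inter_edges (hG : G.IsAcyclic) {n : ℕ} (u v : Level G ρ n) :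
    (u.edges ∩ v.edges).card = meetNat n u.rep v.rep := by
  have : u.edges ∩ v.edges = (Finset.range (meetNat n u.rep v.rep)).image u.rep.edge := by
    ext e
    simp only [Finset.mem_inter, Level.mem_edges, Finset.mem_image, Finset.mem_range,
      lt_meetNat_iff]
    constructor
    · rintro ⟨⟨j, hj, rfl⟩, k, hk, h⟩
      obtain ⟨rfl, h'⟩ := Ray.edge_eq_edge hG h.symm
      exact ⟨j, ⟨hj, h'⟩, rfl⟩
    · rintro ⟨j, ⟨hj, h⟩, rfl⟩
      exact ⟨⟨j, hj, rfl⟩, j, hj, (Ray.edge_congr h).symm⟩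
  rw [this, Finset.card_image_of_injective _ (Ray.edge_injective hG _), Finset.card_range]

/-- Words with a prescribed prefix form an interval in the lexicographic order. -/
theorem lex_between {A : Type*} [LinearOrder A] {m : ℕ} {a b c : Fin m → A}
    (hab : toLex a ≤ toLex b) (hbc : toLex b ≤ toLex c) {k : ℕ}
    (hac : ∀ i : Fin m, (i : ℕ) < k → a i = c i) (i : Fin m) (hi : (i : ℕ) < k) : b i = a i := by
  induction i using WellFoundedLT.induction with
  | ind i ih =>
    have ih' : ∀ j < i, b j = a j := fun j hj => ih j hj (lt_trans hj hi)
    rcases lt_trichotomy (b i) (a i) with h | h | h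
    · exact absurd hab (not_le.2 ⟨i, ih', h⟩)
    · exact h
    · refine absurd hbc (not_le.2 ⟨i, fun j hj => ?_, ?_⟩)
      · exact ((ih' j hj).trans (hac j (lt_trans hj hi))).symm
      · change c i < b i
        rwa [← hac i hi]

open Classical in
theorem Level.edges_planar [LinearOrder V] (hG : G.IsAcyclic) {n : ℕ} (u v w : Level G ρ n)
    (huv : toLex u.1 ≤ toLex v.1) (hvw : toLex v.1 ≤ toLex w.1) :
    u.edges ∩ w.edges ⊆ v.edges := by
  intro e he
  obtain ⟨h1, h2⟩ := Finset.mem_inter.1 he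
  obtain ⟨j, hj, rfl⟩ := Level.mem_edges.1 h1
  obtain ⟨k, hk, h⟩ := Level.mem_edges.1 h2
  obtain ⟨rfl, h'⟩ := Ray.edge_eq_edge hG h.symm
  refine Level.mem_edges.2 ⟨j, hj, Ray.edge_congr fun i hi => ?_⟩
  rw [v.rep_apply (by omega), u.rep_apply (by omega)]
  -- Edge `j` involves the vertices with indices 0, ..., j + 1, hence a common prefix of length j +
  -- 2.
  refine lex_between huv hvw (k := j + 2) (fun l hl => ?_) ⟨i, _⟩ (by simp; omega)
  have := h' l (by omega)
  rwa [u.rep_apply l.2, w.rep_apply l.2] at this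

-- No embedding in the plane is needed: an arbitrary linear order on the vertices, extended
-- lexicographically to paths from the root, orders each level compatibly with the tree.
open Classical in
theorem exists_planar_order {V : Type u} {G : SimpleGraph V} {ρ : V} (hG : G.IsAcyclic) (n : ℕ) :
    ∃ (A : Type u) (_ : LinearOrder A) (α : Level G ρ n → A), ∀ u v w, α u ≤ α v → α v ≤ α w →
      u.edges ∩ w.edges ⊆ v.edges := by
  let _ : LinearOrder V := linearOrderOfSTO WellOrderingRel
  exact ⟨Lex (Fin (n + 1) → V), inferInstance, fun u => toLex u.1, fun u v w huv hvw => by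
    convert Level.edges_planar hG u v w huv hvw⟩

theorem openTo_iff_exists_level {n : ℕ} {η : G.edgeSet → Bool} :
    OpenTo G ρ n η ↔ ∃ u : Level G ρ n, ∀ e ∈ u.edges, η e = true := by
  constructor
  · rintro ⟨v, hv⟩
    refine ⟨v.level n, fun e he => ?_⟩
    obtain ⟨k, hk, rfl⟩ := Level.mem_edges.1 he
    rw [Ray.edge_congr (w := v) fun i hi => v.rep_level (by omega)]
    exact hv k hk
  · rintro ⟨u, hu⟩
    exact ⟨u.rep, fun k hk => hu _ (Level.mem_edges.2 ⟨k, hk, rfl⟩)⟩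

open Classical in
/-- All edges that lie on some ray below level `n`. -/
noncomputable def levelEdges (G : SimpleGraph V) [G.LocallyFinite] (ρ : V) (n : ℕ) :
    Finset G.edgeSet :=
  Finset.univ.biUnion fun u : Level G ρ n => u.edges

theorem Level.edges_subset [G.LocallyFinite] {n : ℕ} (u : Level G ρ n) :
    u.edges ⊆ levelEdges G ρ n := by
  classical
  exact Finset.subset_biUnion_of_mem (fun u : Level G ρ n => u.edges) (Finset.mem_univ u)

theorem openTo_congr [G.LocallyFinite] {n : ℕ} {η ξ : G.edgeSet → Bool}
    (h : ∀ e ∈ levelEdges G ρ n, η e = ξ e) : OpenTo G ρ n η ↔ OpenTo G ρ n ξ := by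
  rw [openTo_iff_exists_level, openTo_iff_exists_level]
  refine exists_congr fun u => forall_congr' fun e => forall_congr' fun he => ?_
  rw [h e (u.edges_subset he)]

end Levels

/-! ### From the finite model to dynamical percolation -/

section Transfer

variable {V Ω : Type*} [MeasurableSpace Ω] {G : SimpleGraph V} {ρ : V} {p : I} {P : Measure Ω}
  {X : G.edgeSet → ℝ≥0 → Ω → Bool}

theorem IsDynamicalPercolation.measurableSet (hX : IsDynamicalPercolation G p P X)
    (e : G.edgeSet) (t : ℝ≥0) (b : Bool) : MeasurableSet {ω | X e t ω = b} :=
  (hX.edge e).measurable t (measurableSet_singleton b)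

theorem IsDynamicalPercolation.measurableSet_openTo [G.LocallyFinite]
    (hX : IsDynamicalPercolation G p P X) (n : ℕ) (t : ℝ≥0) :
    MeasurableSet {ω | OpenTo G ρ n fun e => X e t ω} := by
  simp only [openTo_iff_exists_level, Set.ofPred_exists, Set.ofPred_forall]
  exact MeasurableSet.iUnion fun u => u.edges.measurableSet_biInter fun e _ =>
    hX.measurableSet e t true

/-- The event that at some time in `S` some ray is open up to level `n`. -/
def hitEvent (ρ : V) (X : G.edgeSet → ℝ≥0 → Ω → Bool) (n : ℕ) (S : Set ℝ≥0) : Set Ω :=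
  {ω | ∃ t ∈ S, OpenTo G ρ n fun e => X e t ω}

theorem IsDynamicalPercolation.measurableSet_hitEvent [G.LocallyFinite]
    (hX : IsDynamicalPercolation G p P X) (n : ℕ) {S : Set ℝ≥0} (hS : S.Countable) :
    MeasurableSet (hitEvent ρ X n S) := by
  have : hitEvent ρ X n S = ⋃ t ∈ S, {ω | OpenTo G ρ n fun e => X e t ω} := by
    ext ω
    simp [hitEvent]
  rw [this]
  exact MeasurableSet.biUnion hS fun t _ => hX.measurableSet_openTo n t

theorem IsDynamicalPercolation.prodWeight_eq (hX : IsDynamicalPercolation G p P X)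
    (F : Finset G.edgeSet) (S : Finset ℝ≥0) (η : F → S → Bool) :
    prodWeight (fun e : F => edgeWeight P (X e) S) η =
      P.real {ω | ∀ (e : F) (t : S), X e t ω = η e t} := by
  have hind : iIndepFun (fun (e : F) ω t => X e t ω) P :=
    hX.indep.precomp Subtype.val_injective
  have := hind.meas_iInter (s := fun e : F => {ω | ∀ t : S, X e t ω = η e t}) fun e => by
    refine ⟨{f : ℝ≥0 → Bool | ∀ t : S, f t = η e t}, ?_, rfl⟩
    rw [Set.ofPred_forall]
    exact MeasurableSet.iInter fun t : S =>
      (measurable_pi_apply (t : ℝ≥0) : Measurable fun f : ℝ≥0 → Bool => f t)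
        (measurableSet_singleton (η e t))
  rw [Set.ofPred_forall, measureReal_def, this, ENNReal.toReal_prod]
  rfl

variable [IsProbabilityMeasure P]

open Classical in
theorem IsDynamicalPercolation.mean_eq (hX : IsDynamicalPercolation G p P X)
    (F : Finset G.edgeSet) (S : Finset ℝ≥0) (q : (F → S → Bool) → Prop) :
    mean (prodWeight fun e : F => edgeWeight P (X e) S) (fun η => if q η then 1 else 0) =
      P.real {ω | q fun e t => X e t ω} := by
  have hmeas : ∀ η : F → S → Bool, MeasurableSet {ω | ∀ (e : F) (t : S), X e t ω = η e t} :=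
    fun η => by
      simp only [Set.ofPred_forall]
      exact MeasurableSet.iInter fun e => MeasurableSet.iInter fun t =>
        hX.measurableSet e t (η e t)
  have h1 : mean (prodWeight fun e : F => edgeWeight P (X e) S) (fun η => if q η then 1 else 0) =
      ∑ η with q η, P.real {ω | ∀ (e : F) (t : S), X e t ω = η e t} := by
    simp only [mean, mul_ite, mul_one, mul_zero]
    rw [← Finset.sum_filter]
    exact Finset.sum_congr rfl fun η _ => hX.prodWeight_eq F S η
  rw [h1, ← measureReal_biUnion_finset (fun η _ ξ _ hne => ?_) (fun η _ => hmeas η)]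
  · congr 1
    ext ω
    simp only [Set.mem_iUnion, Finset.mem_filter, Finset.mem_univ, true_and, Set.mem_ofPred_eq,
      exists_prop]
    constructor
    · rintro ⟨η, hq, hη⟩
      rwa [show (fun (e : F) (t : S) => X e t ω) = η from funext fun e => funext (hη e)]
    · exact fun h => ⟨_, h, fun _ _ => rfl⟩
  · refine Set.disjoint_left.2 fun ω h1 h2 => hne (funext fun e => funext fun t => ?_)
    exact (h1 e t).symm.trans (h2 e t)

open Classical in
/-- The edges of the path to a vertex, inside the finite set of all edges below level `n`. -/
noncomputable def Level.path [G.LocallyFinite] {n : ℕ} (u : Level G ρ n) :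
    Finset (levelEdges G ρ n) :=
  u.edges.subtype (· ∈ levelEdges G ρ n)

open Classical in
theorem Level.card_inter_path [G.LocallyFinite] (hG : G.IsAcyclic) {n : ℕ} (u v : Level G ρ n) :
    (u.path ∩ v.path).card = meetNat n u.rep v.rep := by
  rw [← Level.card_inter_edges hG]
  have : (u.path ∩ v.path).map (Function.Embedding.subtype _) = u.edges ∩ v.edges := by
    have hsub : u.path ∩ v.path = (u.edges ∩ v.edges).subtype (· ∈ levelEdges G ρ n) := by
      ext e
      simp only [Level.path, Finset.mem_inter, Finset.mem_subtype]
    rw [hsub, Finset.subtype_map,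
      Finset.filter_true_of_mem fun e he => u.edges_subset (Finset.mem_inter.1 he).1]
  rw [← this, Finset.card_map]

open Classical in
theorem IsDynamicalPercolation.mean_hitSet [G.LocallyFinite] (hX : IsDynamicalPercolation G p P X)
   
    (n : ℕ) (S : Finset ℝ≥0) :
    mean (prodWeight fun e : levelEdges G ρ n => edgeWeight P (X e) S)
      (fun η => if HitSet (T := S) (Level.path (G := G) (ρ := ρ) (n := n)) η then 1 else 0) =
      P.real (hitEvent ρ X n S) := by
  rw [hX.mean_eq (levelEdges G ρ n) S (HitSet (Level.path (G := G) (ρ := ρ) (n := n)))]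
  congr 1
  ext ω
  simp only [hitEvent, HitSet, Set.mem_ofPred_eq, openTo_iff_exists_level]
  constructor
  · rintro ⟨⟨u, t⟩, hu⟩
    exact ⟨t, t.2, u, fun e he => hu ⟨e, u.edges_subset he⟩ (Finset.mem_subtype.2 he)⟩
  · rintro ⟨t, ht, u, hu⟩
    exact ⟨⟨u, t, ht⟩, fun e he => hu e (Finset.mem_subtype.1 he)⟩

theorem IsDynamicalPercolation.one_le_hit_mul_energy [G.LocallyFinite] (hG : G.IsAcyclic)
    (hp : 0 < (p : ℝ)) (hX : IsDynamicalPercolation G p P X) (n : ℕ) (S : Finset ℝ≥0)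
    {μ : Level G ρ n × S → ℝ} (hμ : ∑ x, μ x = 1) :
    1 ≤ P.real (hitEvent ρ X n S) *
      ∑ x, ∑ y, μ x * μ y * rate p x.2 y.2 ^ meetNat n x.1.rep y.1.rep := by
  classical
  have := one_le_mean_hit_mul_energy hp (fun e : levelEdges G ρ n => (hX.edge e).edgeLaw hp S)
    Level.path hμ
  rw [hX.mean_hitSet] at this
  simpa only [Level.card_inter_path hG] using this

theorem IsDynamicalPercolation.exists_hit_mul_energy_le [G.LocallyFinite] (hG : G.IsAcyclic)
    (hp : 0 < (p : ℝ)) (hX : IsDynamicalPercolation G p P X) (n : ℕ) (S : Finset ℝ≥0)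
    (hpos : 0 < P.real (hitEvent ρ X n S)) :
    ∃ μ : Level G ρ n × S → ℝ, 0 ≤ μ ∧ ∑ x, μ x = 1 ∧ P.real (hitEvent ρ X n S) *
      ∑ x, ∑ y, μ x * μ y * rate p x.2 y.2 ^ meetNat n x.1.rep y.1.rep ≤ 256 := by
  classical
  obtain ⟨A, _, α, hα⟩ := exists_planar_order (ρ := ρ) hG n
  have hplanar : ∀ u v w : Level G ρ n, α u ≤ α v → α v ≤ α w → u.path ∩ w.path ⊆ v.path := by
    intro u v w huv hvw e he
    simp only [Level.path, Finset.mem_inter, Finset.mem_subtype] at he ⊢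
    exact hα u v w huv hvw (Finset.mem_inter.2 he)
  have := exists_energy_le hp (fun i j : S => zero_le_one.trans (one_le_rate p i j))
    (fun e : levelEdges G ρ n => (hX.edge e).edgeLaw hp S)
    (fun e => (hX.edge e).edgeMarkov hp S) (fun e => (hX.edge e).edgeMarkov_dual hp S) hplanar
    (by rwa [hX.mean_hitSet])
  rw [hX.mean_hitSet] at this
  simpa only [Level.card_inter_path hG] using this

end Transfer

/-! ### Truncated kernels, energies and weak limits -/

section TruncatedKernel

variable {V : Type*} {G : SimpleGraph V} {ρ : V}

/-- The kernel `kernelH` with the height of the meet truncated at level `n`. -/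
noncomputable def kernelTrunc (p : ℝ) (n : ℕ) (x y : Ray G ρ × ℝ≥0) : ℝ :=
  rate p x.2 y.2 ^ meetNat n x.1 y.1

theorem meetNat_mono {m n : ℕ} (hmn : m ≤ n) (v w : Ray G ρ) : meetNat m v w ≤ meetNat n v w := by
  rw [← Nat.cast_le (α := ℕ∞), natCast_meetNat, natCast_meetNat]
  exact min_le_min_right _ (Nat.cast_le.2 hmn)

theorem kernelTrunc_mono (p : I) {m n : ℕ} (hmn : m ≤ n) (x y : Ray G ρ × ℝ≥0) :
    kernelTrunc p m x y ≤ kernelTrunc p n x y :=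
  pow_le_pow_right₀ (one_le_rate p _ _) (meetNat_mono hmn _ _)

theorem continuous_rate (p : ℝ) : Continuous fun x : ℝ≥0 × ℝ≥0 => rate p x.1 x.2 := by
  unfold rate
  fun_prop

theorem eventually_meetNat_eq (n : ℕ) (v w : Ray G ρ) :
    ∀ᶠ x : Ray G ρ × Ray G ρ in 𝓝 (v, w), meetNat n x.1 x.2 = meetNat n v w := by
  rw [nhds_prod_eq]
  filter_upwards [prod_mem_prod (v.nhds_hasBasis.mem_of_mem (i := n) trivial)
    (w.nhds_hasBasis.mem_of_mem (i := n) trivial)] with x hx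
  refine eq_of_forall_lt_iff fun k => ?_
  rw [lt_meetNat_iff, lt_meetNat_iff]
  refine and_congr_right fun hk => forall_congr' fun i => forall_congr' fun hi => ?_
  rw [hx.1 i (by omega), hx.2 i (by omega)]

theorem continuous_kernelTrunc (p : ℝ) (n : ℕ) :
    Continuous fun z : (Ray G ρ × ℝ≥0) × (Ray G ρ × ℝ≥0) => kernelTrunc p n z.1 z.2 := by
  rw [continuous_iff_continuousAt]
  intro z
  have h1 : ContinuousAt (fun y : (Ray G ρ × ℝ≥0) × (Ray G ρ × ℝ≥0) =>
      rate p y.1.2 y.2.2 ^ meetNat n z.1.1 z.2.1) z := by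
    have : Continuous fun y : (Ray G ρ × ℝ≥0) × (Ray G ρ × ℝ≥0) => rate p y.1.2 y.2.2 :=
      (continuous_rate p).comp (by fun_prop : Continuous
        fun y : (Ray G ρ × ℝ≥0) × (Ray G ρ × ℝ≥0) => (y.1.2, y.2.2))
    exact (this.pow _).continuousAt
  refine h1.congr ?_
  have h2 : Tendsto (fun y : (Ray G ρ × ℝ≥0) × (Ray G ρ × ℝ≥0) => (y.1.1, y.2.1)) (𝓝 z)
      (𝓝 (z.1.1, z.2.1)) := by
    have : Continuous fun y : (Ray G ρ × ℝ≥0) × (Ray G ρ × ℝ≥0) => (y.1.1, y.2.1) := by fun_prop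
    exact this.tendsto z
  filter_upwards [h2.eventually (eventually_meetNat_eq n z.1.1 z.2.1)] with y hy
  rw [kernelTrunc, hy]

theorem kernelH_eq_of_ne_top {p : ℝ} {x y : Ray G ρ × ℝ≥0} (h : meetHeight x.1 y.1 ≠ ⊤) :
    kernelH p x y = ENNReal.ofReal (rate p x.2 y.2 ^ (meetHeight x.1 y.1).toNat) :=
  if_neg h

/-- Truncation is inactive once n reaches a finite meet height. For equal rays the exponent is n and
the base exceeds 1, as p < 1, so the supremum is infinite. -/
theorem kernelH_eq_iSup {p : I} (hp0 : 0 < p) (hp1 : p < 1) (x y : Ray G ρ × ℝ≥0) :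
    kernelH p x y = ⨆ n, ENNReal.ofReal (kernelTrunc p n x y) := by
  have hp0' : 0 < (p : ℝ) := hp0
  have hp1' : (p : ℝ) < 1 := hp1
  refine le_antisymm ?_ (iSup_le fun n => ?_)
  · by_cases h : meetHeight x.1 y.1 = ⊤
    · have h1 : ∀ n, kernelTrunc p n x y = rate p x.2 y.2 ^ n := by
        intro n
        rw [kernelTrunc, meetNat, h, min_eq_left le_top, ENat.toNat_natCast]
      have h2 : 1 < rate p x.2 y.2 := by
        unfold rate
        have : 0 < (1 - (p : ℝ)) / p := div_pos (by linarith) hp0'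
        have := mul_pos this (Real.exp_pos (-|(x.2 : ℝ) - (y.2 : ℝ)|))
        linarith
      simp only [h1]
      have h3 := ENNReal.tendsto_ofReal_atTop.comp (tendsto_pow_atTop_atTop_of_one_lt h2)
      have h4 : ⨆ n, ENNReal.ofReal (rate p x.2 y.2 ^ n) = ⊤ := by
        refine top_le_iff.1 (le_of_tendsto h3 (Eventually.of_forall fun n => ?_))
        exact le_iSup (fun n => ENNReal.ofReal (rate p x.2 y.2 ^ n)) n
      rw [h4]
      exact le_top
    · rw [kernelH_eq_of_ne_top h]
      refine le_iSup_of_le (meetHeight x.1 y.1).toNat ?_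
      rw [kernelTrunc, meetNat, ENat.natCast_toNat h, min_self]
  · by_cases h : meetHeight x.1 y.1 = ⊤
    · rw [kernelH, if_pos h]
      exact le_top
    · rw [kernelH_eq_of_ne_top h]
      refine ENNReal.ofReal_le_ofReal (pow_le_pow_right₀ (one_le_rate p _ _) ?_)
      exact ENat.toNat_le_toNat (min_le_right _ _) h

variable [G.LocallyFinite]

theorem measurable_kernelTrunc (p : ℝ) (n : ℕ) :
    Measurable fun z : (Ray G ρ × ℝ≥0) × (Ray G ρ × ℝ≥0) =>
      ENNReal.ofReal (kernelTrunc p n z.1 z.2) :=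
  (continuous_kernelTrunc p n).measurable.ennreal_ofReal

theorem measurable_kernelH {p : I} (hp0 : 0 < p) (hp1 : p < 1) :
    Measurable fun z : (Ray G ρ × ℝ≥0) × (Ray G ρ × ℝ≥0) => kernelH p z.1 z.2 := by
  simp only [kernelH_eq_iSup hp0 hp1]
  exact Measurable.iSup fun n => measurable_kernelTrunc p n

theorem energy_kernelH_eq_iSup {p : I} (hp0 : 0 < p) (hp1 : p < 1)
    (μ : Measure (Ray G ρ × ℝ≥0)) [SFinite μ] :
    energy (kernelH p) μ = ⨆ n, energy (fun x y => ENNReal.ofReal (kernelTrunc p n x y)) μ := by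
  have hm : Monotone fun n (z : (Ray G ρ × ℝ≥0) × (Ray G ρ × ℝ≥0)) =>
      ENNReal.ofReal (kernelTrunc p n z.1 z.2) :=
    fun m n hmn z => ENNReal.ofReal_le_ofReal (kernelTrunc_mono p hmn _ _)
  unfold energy
  rw [← lintegral_prod (fun z => kernelH p z.1 z.2) (measurable_kernelH hp0 hp1).aemeasurable]
  simp only [kernelH_eq_iSup hp0 hp1]
  rw [lintegral_iSup (measurable_kernelTrunc p) hm]
  refine iSup_congr fun n => ?_
  exact lintegral_prod (fun z => ENNReal.ofReal (kernelTrunc p n z.1 z.2))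
    (measurable_kernelTrunc p n).aemeasurable

omit [G.LocallyFinite] in
/-- Along a sequence of probability measures on a compact space whose energies with respect to an
increasing sequence of kernels are bounded, there is a limit with bounded energies. -/
theorem exists_forall_energy_le {K : Type*} [MetricSpace K] [CompactSpace K] [MeasurableSpace K]
    [BorelSpace K] (f : ℕ → C(K × K, ℝ≥0)) (hf : Monotone f) (C : ℝ≥0∞)
    (μ : ℕ → ProbabilityMeasure K)
    (h : ∀ n, ∫⁻ x, ∫⁻ y, f n (x, y) ∂(μ n : Measure K) ∂(μ n : Measure K) ≤ C) :
    ∃ ν : ProbabilityMeasure K,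
      ∀ k, ∫⁻ x, ∫⁻ y, f k (x, y) ∂(ν : Measure K) ∂(ν : Measure K) ≤ C := by
  -- Probability measures on a compact space form a compact space, so a limit along a nonprincipal
  -- ultrafilter exists and no subsequence need be chosen.
  set F : Ultrafilter (ProbabilityMeasure K) := (hyperfilter ℕ).map μ with hF
  have hlim : Tendsto μ (hyperfilter ℕ) (𝓝 F.lim) := F.le_nhds_lim
  have hprod : ∀ k (ν : ProbabilityMeasure K),
      ∫⁻ z, f k z ∂((ν.prod ν : ProbabilityMeasure _) : Measure (K × K)) =
      ∫⁻ x, ∫⁻ y, f k (x, y) ∂(ν : Measure K) ∂(ν : Measure K) := fun k ν => by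
    rw [ProbabilityMeasure.toMeasure_prod]
    exact lintegral_prod (fun z => (f k z : ℝ≥0∞))
      (f k).continuous.measurable.coe_nnreal_ennreal.aemeasurable
  -- The square of a measure depends weakly continuously on it, so the energy of each fixed
  -- continuous kernel passes to the limit; that kernel lies below `f n` for all later n.
  have hc : Continuous fun ν : ProbabilityMeasure K => ν.prod ν :=
    ProbabilityMeasure.continuous_prod.comp (continuous_id.prodMk continuous_id)
  refine ⟨F.lim, fun k => ?_⟩
  have h1 : Tendsto (fun n => ∫⁻ z, f k z
      ∂(((μ n).prod (μ n) : ProbabilityMeasure _) : Measure (K × K))) (hyperfilter ℕ)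
      (𝓝 (∫⁻ z, f k z ∂((F.lim.prod F.lim : ProbabilityMeasure _) : Measure (K × K)))) :=
    (((ProbabilityMeasure.continuous_lintegral_continuousMap (f k)).comp hc).tendsto F.lim).comp hlim
  simp only [hprod] at h1
  refine le_of_tendsto h1 ?_
  have h2 : ∀ᶠ n in (hyperfilter ℕ : Filter ℕ), k ≤ n :=
    Nat.hyperfilter_le_atTop (eventually_ge_atTop k)
  filter_upwards [h2] with n hn
  refine le_trans ?_ (h n)
  gcongr with x y
  exact hf hn (x, y)

/-- Weak limits of measures with bounded truncated energies have bounded energy. -/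
theorem exists_energy_le_of_seq {p : I} (hp0 : 0 < p) (hp1 : p < 1) {D : Set ℝ≥0}
    (hD : IsCompact D) (C : ℝ≥0∞) (μ : ℕ → ProbabilityMeasure (Ray G ρ × D))
    (h : ∀ n, ∫⁻ x, ∫⁻ y, ENNReal.ofReal (kernelTrunc p n (x.1, (x.2 : ℝ≥0)) (y.1, (y.2 : ℝ≥0)))
      ∂(μ n : Measure (Ray G ρ × D)) ∂(μ n : Measure (Ray G ρ × D)) ≤ C) :
    ∃ ν : ProbabilityMeasure (Ray G ρ × ℝ≥0),
      (ν : Measure (Ray G ρ × ℝ≥0)) (Set.univ ×ˢ D)ᶜ = 0 ∧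
        energy (kernelH p) (ν : Measure (Ray G ρ × ℝ≥0)) ≤ C := by
  have : CompactSpace D := isCompact_iff_compactSpace.1 hD
  let g : Ray G ρ × D → Ray G ρ × ℝ≥0 := fun x => (x.1, (x.2 : ℝ≥0))
  have hgc : Continuous g := by fun_prop
  have hgg : Continuous fun z : (Ray G ρ × D) × (Ray G ρ × D) => (g z.1, g z.2) := by fun_prop
  have hfc : ∀ k, Continuous fun z : (Ray G ρ × D) × (Ray G ρ × D) =>
      (kernelTrunc p k (g z.1) (g z.2)).toNNReal := fun k => by
    have h1 := (continuous_kernelTrunc (G := G) (ρ := ρ) (p : ℝ) k).comp hgg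
    exact continuous_real_toNNReal.comp h1
  let f : ℕ → C((Ray G ρ × D) × (Ray G ρ × D), ℝ≥0) := fun k => ⟨_, hfc k⟩
  obtain ⟨ν, hν⟩ := exists_forall_energy_le f
    (fun m n hmn z => Real.toNNReal_le_toNNReal (kernelTrunc_mono p hmn _ _)) C μ h
  refine ⟨ν.map hgc.measurable.aemeasurable, ?_, ?_⟩
  · rw [ProbabilityMeasure.toMeasure_map, Measure.map_apply hgc.measurable
      (MeasurableSet.univ.prod hD.measurableSet).compl]
    have : g ⁻¹' (Set.univ ×ˢ D)ᶜ = ∅ := by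
      ext x
      simp [g]
    rw [this, measure_empty]
  · rw [energy_kernelH_eq_iSup hp0 hp1]
    refine iSup_le fun k => ?_
    refine le_trans (le_of_eq ?_) (hν k)
    rw [energy, ProbabilityMeasure.toMeasure_map, lintegral_map
      (measurable_kernelTrunc p k).lintegral_prod_right' hgc.measurable]
    refine lintegral_congr fun x => ?_
    exact lintegral_map ((measurable_kernelTrunc p k).comp (measurable_prodMk_left (x := g x)))
      hgc.measurable

/-- A discrete measure on rays and times that realises given weights. -/
theorem exists_discrete_measure {p : I} {D : Set ℝ≥0} {n : ℕ} {S : Finset ℝ≥0}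
    (hS : (S : Set ℝ≥0) ⊆ D) {m : Level G ρ n × S → ℝ} (hm0 : 0 ≤ m) (hm1 : ∑ x, m x = 1) :
    ∃ μ : ProbabilityMeasure (Ray G ρ × D),
      ∫⁻ x, ∫⁻ y, ENNReal.ofReal (kernelTrunc p n (x.1, (x.2 : ℝ≥0)) (y.1, (y.2 : ℝ≥0)))
        ∂(μ : Measure (Ray G ρ × D)) ∂(μ : Measure (Ray G ρ × D)) =
      ENNReal.ofReal (∑ x, ∑ y, m x * m y * rate p x.2 y.2 ^ meetNat n x.1.rep y.1.rep) := by
  set pt : Level G ρ n × S → Ray G ρ × D := fun x => (x.1.rep, ⟨x.2, hS x.2.2⟩) with hpt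
  set μ : Measure (Ray G ρ × D) := ∑ x, ENNReal.ofReal (m x) • Measure.dirac (pt x) with hμ
  have hint : ∀ f : Ray G ρ × D → ℝ≥0∞, ∫⁻ x, f x ∂μ = ∑ x, ENNReal.ofReal (m x) * f (pt x) := by
    intro f
    rw [hμ, lintegral_finsetSum_measure]
    refine Finset.sum_congr rfl fun x _ => ?_
    rw [lintegral_smul_measure, lintegral_dirac, smul_eq_mul]
  have hprob : IsProbabilityMeasure μ := by
    constructor
    have := hint 1
    simp only [Pi.one_apply, lintegral_one, mul_one] at this
    rw [this, ← ENNReal.ofReal_sum_of_nonneg fun x _ => hm0 x, hm1, ENNReal.ofReal_one]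
  refine ⟨⟨μ, hprob⟩, ?_⟩
  change ∫⁻ x, ∫⁻ y, _ ∂μ ∂μ = _
  have hr : ∀ x y : Level G ρ n × S, 0 ≤ rate p x.2 y.2 ^ meetNat n x.1.rep y.1.rep :=
    fun x y => pow_nonneg (zero_le_one.trans (one_le_rate p _ _)) _
  have h0 : ∀ x, 0 ≤ m x := hm0
  simp only [hint]
  rw [ENNReal.ofReal_sum_of_nonneg fun x _ => Finset.sum_nonneg fun y _ =>
    mul_nonneg (mul_nonneg (h0 x) (h0 y)) (hr x y)]
  refine Finset.sum_congr rfl fun x _ => ?_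
  rw [Finset.mul_sum, ENNReal.ofReal_sum_of_nonneg fun y _ =>
    mul_nonneg (mul_nonneg (h0 x) (h0 y)) (hr x y)]
  refine Finset.sum_congr rfl fun y _ => ?_
  rw [ENNReal.ofReal_mul (mul_nonneg (h0 x) (h0 y)), ENNReal.ofReal_mul (h0 x), mul_assoc]
  rfl

end TruncatedKernel

/-! ### The capacity upper bound -/

section UpperBound

variable {V Ω : Type*} [MeasurableSpace Ω] {G : SimpleGraph V} {ρ : V} {p : I} {P : Measure Ω}
  {X : G.edgeSet → ℝ≥0 → Ω → Bool}

/-- Every set of times has a countable subset that is dense from the right. -/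
theorem exists_countable_dense_right (D : Set ℝ≥0) :
    ∃ D' ⊆ D, D'.Countable ∧ ∀ t ∈ D, ∀ U ∈ 𝓝[≥] t, ∃ s ∈ D', s ∈ U := by
  obtain ⟨A, hAc, hAd⟩ := TopologicalSpace.exists_countable_dense D
  -- A dense sequence misses only points of `D` that are isolated from the right in `D`; these are
  -- countably many and are added.
  refine ⟨Subtype.val '' A ∪ {t ∈ D | 𝓝[D ∩ Set.Ioi t] t = ⊥}, ?_, ?_, fun t ht U hU => ?_⟩
  · rintro t (⟨s, -, rfl⟩ | h)
    · exact s.2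
    · exact h.1
  · exact (hAc.image _).union countable_setOfPred_isolated_right_within
  · by_cases h : 𝓝[D ∩ Set.Ioi t] t = ⊥
    · exact ⟨t, Or.inr ⟨ht, h⟩, mem_of_mem_nhdsWithin Set.self_mem_Ici hU⟩
    · obtain ⟨b, hb, hbU⟩ := mem_nhdsGE_iff_exists_Ico_subset.1 hU
      have hne : (𝓝[D ∩ Set.Ioi t] t).NeBot := ⟨h⟩
      obtain ⟨u, ⟨huD, htu⟩, hub⟩ :=
        hne.nonempty_of_mem (inter_mem self_mem_nhdsWithin
          (mem_nhdsWithin_of_mem_nhds (Iio_mem_nhds hb)))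
      have hopen : IsOpen (Subtype.val ⁻¹' Set.Ioo t b : Set D) :=
        isOpen_Ioo.preimage continuous_subtype_val
      obtain ⟨s, ⟨hts, hsb⟩, hsA⟩ := hAd.inter_open_nonempty _ hopen ⟨⟨u, huD⟩, htu, hub⟩
      exact ⟨s, Or.inl ⟨s, hsA, rfl⟩, hbU ⟨le_of_lt hts, hsb⟩⟩

/-- The paths of the edges below level `n` are càdlàg. -/
def CadlagUpTo [G.LocallyFinite] (ρ : V) (X : G.edgeSet → ℝ≥0 → Ω → Bool) (n : ℕ) (ω : Ω) : Prop :=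
  ∀ e ∈ levelEdges G ρ n, ∀ t : ℝ≥0, ContinuousWithinAt (fun s => X e s ω) (Set.Ici t) t ∧
    ∃ b, Tendsto (fun s => X e s ω) (𝓝[<] t) (𝓝 b)

theorem IsDynamicalPercolation.ae_cadlagUpTo [G.LocallyFinite]
    (hX : IsDynamicalPercolation G p P X) : ∀ᵐ ω ∂P, ∀ n, CadlagUpTo ρ X n ω := by
  rw [ae_all_iff]
  intro n
  exact (ae_ball_iff (levelEdges G ρ n).countable_toSet).2 fun e _ => (hX.edge e).cadlag

omit [MeasurableSpace Ω] in
theorem CadlagUpTo.eventually_right [G.LocallyFinite] {n : ℕ} {ω : Ω} (h : CadlagUpTo ρ X n ω)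
    (t : ℝ≥0) : ∀ᶠ s in 𝓝[≥] t, ∀ e ∈ levelEdges G ρ n, X e s ω = X e t ω := by
  rw [Filter.eventually_all_finset]
  intro e he
  have := (h e he t).1
  rw [ContinuousWithinAt, nhds_discrete, tendsto_pure] at this
  exact this

/-- Reaching level n depends on finitely many edges, whose states a.s. stay constant for a while
after each time t. -/
theorem IsDynamicalPercolation.hitEvent_ae_eq [G.LocallyFinite]
    (hX : IsDynamicalPercolation G p P X) {D D' : Set ℝ≥0} (hsub : D' ⊆ D)
    (hD' : ∀ t ∈ D, ∀ U ∈ 𝓝[≥] t, ∃ s ∈ D', s ∈ U) (n : ℕ) :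
    hitEvent ρ X n D =ᵐ[P] hitEvent ρ X n D' := by
  filter_upwards [hX.ae_cadlagUpTo (ρ := ρ)] with ω hω
  refine propext ⟨?_, fun ⟨t, ht, h⟩ => ⟨t, hsub ht, h⟩⟩
  rintro ⟨t, ht, h⟩
  obtain ⟨s, hs, hsU⟩ := hD' t ht _ ((hω n).eventually_right t)
  exact ⟨s, hs, (openTo_congr hsU).2 h⟩

omit [MeasurableSpace Ω] in
theorem percolatesDuring_subset_hitEvent [G.LocallyFinite] (D : Set ℝ≥0) (n : ℕ) :
    percolatesDuring G ρ X D ⊆ hitEvent ρ X n D := by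
  intro ω hω
  obtain ⟨t, ht, h⟩ := Set.mem_iUnion₂.1 hω
  exact ⟨t, ht, percolates_iff.1 h n⟩

/-- After passing to a countable set of times, the event is a directed union over its finite
subsets. -/
theorem IsDynamicalPercolation.exists_finset_lt [G.LocallyFinite]
    (hX : IsDynamicalPercolation G p P X) (D : Set ℝ≥0) (n : ℕ) {c : ℝ≥0∞}
    (hc : c < P (hitEvent ρ X n D)) :
    ∃ S : Finset ℝ≥0, (S : Set ℝ≥0) ⊆ D ∧ c < P (hitEvent ρ X n S) := by
  classical
  obtain ⟨D', hsub, hcount, hD'⟩ := exists_countable_dense_right D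
  have : Countable D' := hcount
  rw [measure_congr (hX.hitEvent_ae_eq hsub hD' n)] at hc
  have hU : hitEvent ρ X n D' =
      ⋃ S : Finset D', hitEvent ρ X n (S.map (Function.Embedding.subtype _) : Finset ℝ≥0) := by
    ext ω
    simp only [hitEvent, Set.mem_iUnion, Set.mem_ofPred_eq]
    constructor
    · rintro ⟨t, ht, h⟩
      exact ⟨{⟨t, ht⟩}, t, by simp, h⟩
    · rintro ⟨S, t, ht, h⟩
      simp only [Finset.coe_map, Function.Embedding.coe_subtype, Set.mem_image] at ht
      obtain ⟨s, -, rfl⟩ := ht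
      exact ⟨s, s.2, h⟩
  have hdir : Directed (· ⊆ ·) fun S : Finset D' =>
      hitEvent ρ X n (S.map (Function.Embedding.subtype _) : Finset ℝ≥0) := by
    refine Monotone.directed_le fun S T hST ω => ?_
    rintro ⟨t, ht, h⟩
    exact ⟨t, Finset.map_subset_map.2 hST ht, h⟩
  rw [hU, hdir.measure_iUnion, lt_iSup_iff] at hc
  obtain ⟨S, hS⟩ := hc
  refine ⟨_, fun t ht => ?_, hS⟩
  simp only [Finset.coe_map, Function.Embedding.coe_subtype, Set.mem_image] at ht
  obtain ⟨s, -, rfl⟩ := ht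
  exact hsub s.2

theorem inv_energy_le_capacity {S : Type*} [MeasurableSpace S] (f : S → S → ℝ≥0∞) {F : Set S}
    (μ : ProbabilityMeasure S) (hμ : (μ : Measure S) Fᶜ = 0) :
    (energy f (μ : Measure S))⁻¹ ≤ capacity f F :=
  ENNReal.inv_le_inv.2 (iInf₂_le μ hμ)

theorem IsDynamicalPercolation.measure_le_capacity [G.LocallyFinite] [IsProbabilityMeasure P]
    (hG : G.IsAcyclic) (hp0 : 0 < p) (hp1 : p < 1) (hX : IsDynamicalPercolation G p P X)
    {D : Set ℝ≥0} (hD : IsCompact D) :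
    P (percolatesDuring G ρ X D) ≤
      512 * capacity (kernelH (G := G) (ρ := ρ) p) (Set.univ ×ˢ D) := by
  set c := P (percolatesDuring G ρ X D) with hc
  rcases eq_or_ne c 0 with h0 | h0
  · rw [h0]
    exact zero_le
  have hctop : c ≠ ⊤ := measure_ne_top P _
  have hseq : ∀ n, ∃ μ : ProbabilityMeasure (Ray G ρ × D),
      ∫⁻ x, ∫⁻ y, ENNReal.ofReal (kernelTrunc p n (x.1, (x.2 : ℝ≥0)) (y.1, (y.2 : ℝ≥0)))
        ∂(μ : Measure (Ray G ρ × D)) ∂(μ : Measure (Ray G ρ × D)) ≤ 512 / c := by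
    intro n
    -- Finitely many times capture any value strictly below the probability. Settling for half of
    -- `c` makes 256 into 512.
    have hlt : c / 2 < P (hitEvent ρ X n D) :=
      (ENNReal.half_lt_self h0 hctop).trans_le
        (measure_mono (percolatesDuring_subset_hitEvent D n))
    obtain ⟨S, hSD, hS⟩ := hX.exists_finset_lt D n hlt
    have hpos : 0 < P.real (hitEvent ρ X n S) :=
      ENNReal.toReal_pos (pos_of_gt hS).ne' (measure_ne_top P _)
    obtain ⟨m, hm0, hm1, hm⟩ := hX.exists_hit_mul_energy_le hG hp0 n S hpos
    obtain ⟨μ, hμ⟩ := exists_discrete_measure (p := p) hSD hm0 hm1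
    refine ⟨μ, ?_⟩
    rw [hμ, ENNReal.le_div_iff_mul_le (Or.inl h0) (Or.inl hctop)]
    have h1 := ENNReal.ofReal_le_ofReal hm
    rw [ENNReal.ofReal_mul measureReal_nonneg, ofReal_measureReal] at h1
    have h2 := (mul_le_mul_left hS.le _).trans h1
    calc _ = 2 * (c / 2 * ENNReal.ofReal
          (∑ x, ∑ y, m x * m y * rate p x.2 y.2 ^ meetNat n x.1.rep y.1.rep)) := by
          rw [← mul_assoc, ENNReal.mul_div_cancel two_ne_zero ENNReal.ofNat_ne_top, mul_comm]
      _ ≤ 2 * ENNReal.ofReal 256 := by gcongr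
      _ = 512 := by
        rw [show (256 : ℝ) = ((256 : ℕ) : ℝ) by norm_num, ENNReal.ofReal_natCast]
        norm_num
  choose μ hμ using hseq
  obtain ⟨ν, hν, hen⟩ := exists_energy_le_of_seq hp0 hp1 hD _ μ hμ
  have h1 : (512 / c)⁻¹ ≤ capacity (kernelH (G := G) (ρ := ρ) p) (Set.univ ×ˢ D) :=
    (ENNReal.inv_le_inv.2 hen).trans (inv_energy_le_capacity _ ν hν)
  calc c = 512 * (512 / c)⁻¹ := by
        rw [ENNReal.inv_div (Or.inl hctop) (Or.inl h0), ENNReal.mul_div_cancel (by norm_num)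
          (by norm_num)]
    _ ≤ _ := by gcongr

end UpperBound

/-! ### Edges closing while the configuration percolates -/

section ExceptionalTimes

variable {V Ω : Type*} [MeasurableSpace Ω] {G : SimpleGraph V} {ρ : V} {p : I} {P : Measure Ω}
  {X : G.edgeSet → ℝ≥0 → Ω → Bool}

theorem measurableSet_setOf_openTo [G.LocallyFinite] (n : ℕ) :
    MeasurableSet {η : G.edgeSet → Bool | OpenTo G ρ n η} := by
  simp only [openTo_iff_exists_level, Set.ofPred_exists, Set.ofPred_forall]
  exact MeasurableSet.iUnion fun u => u.edges.measurableSet_biInter fun e _ =>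
    (measurable_pi_apply e : Measurable fun η : G.edgeSet → Bool => η e) (measurableSet_singleton true)

instance : IsProbabilityMeasure (percolationMeasure G p) := by
  unfold percolationMeasure
  infer_instance

theorem tendsto_percolationMeasure_openTo [G.LocallyFinite] :
    Tendsto (fun n => percolationMeasure G p {η | OpenTo G ρ n η}) atTop
      (𝓝 (percolationMeasure G p {η | Percolates G ρ η})) := by
  have : {η | Percolates G ρ η} = ⋂ n, {η | OpenTo G ρ n η} := by
    ext η
    simp [percolates_iff]
  rw [this]
  exact tendsto_measure_iInter_atTop
    (fun n => (measurableSet_setOf_openTo n).nullMeasurableSet)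
    (fun m n hmn η h => OpenTo.anti hmn h) ⟨0, measure_ne_top _ _⟩

variable [IsProbabilityMeasure P]

theorem IsEdgeProcess.map_eq {Y : ℝ≥0 → Ω → Bool} (hY : IsEdgeProcess p P Y) (t : ℝ≥0) :
    P.map (Y t) = bernoulliMeasure true false p := by
  have := Measure.isProbabilityMeasure_map (μ := P) (hY.measurable t).aemeasurable
  refine Measure.ext_of_singleton fun b => ?_
  rw [← measureReal_eq_measureReal_iff, bernoulliMeasure_real_singleton,
    map_measureReal_apply (hY.measurable t) (measurableSet_singleton b)]
  exact hY.real_eq t b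

theorem IsDynamicalPercolation.measure_openTo [G.LocallyFinite]
    (hX : IsDynamicalPercolation G p P X) (n : ℕ) (t : ℝ≥0) :
    P {ω | OpenTo G ρ n fun e => X e t ω} = percolationMeasure G p {η | OpenTo G ρ n η} := by
  have hm : Measurable fun ω e => X e t ω := measurable_pi_lambda _ fun e => (hX.edge e).measurable t
  have hind : iIndepFun (fun e ω => X e t ω) P :=
    hX.indep.comp (fun _ f => f t) fun _ => measurable_pi_apply t
  have h := hind.map_fun_eq_infinitePi_map₀ hm.aemeasurable
  simp only [fun e => (hX.edge e).map_eq t] at h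
  rw [percolationMeasure, ← h, Measure.map_apply hm (measurableSet_setOf_openTo n)]
  rfl

/-- By independence only the factor of `e` is affected, and there the Markov property applies. -/
theorem IsDynamicalPercolation.real_forall_eq_and (hX : IsDynamicalPercolation G p P X)
    (F : Finset G.edgeSet) (e : F) {s t : ℝ≥0} (hst : s ≤ t) (η : F → Bool) (b : Bool) :
    P.real {ω | (∀ f : F, X f s ω = η f) ∧ X e t ω = b} =
      P.real {ω | ∀ f : F, X f s ω = η f} * edgeTransition p ((t : ℝ) - s) (η e) b := by
  classical
  have hind : iIndepFun (fun (f : F) ω t => X f t ω) P := hX.indep.precomp Subtype.val_injective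
  have hev : ∀ (u : ℝ≥0) (c : Bool), MeasurableSet {g : ℝ≥0 → Bool | g u = c} := fun u c =>
    (measurable_pi_apply u : Measurable fun g : ℝ≥0 → Bool => g u) (measurableSet_singleton c)
  have h1 := hind.meas_iInter (s := fun f : F => {ω | X f s ω = η f}) fun f =>
    ⟨{g | g s = η f}, hev s _, rfl⟩
  have h2 := hind.meas_iInter
    (s := fun f : F => {ω | X f s ω = η f ∧ (f = e → X f t ω = b)}) fun f =>
    ⟨{g | g s = η f ∧ (f = e → g t = b)}, (hev s _).inter (by
      by_cases hfe : f = e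
      · have : {g : ℝ≥0 → Bool | f = e → g t = b} = {g | g t = b} := by
          ext
          simp [hfe]
        exact (congrArg MeasurableSet this).mpr (hev t b)
      · have : {g : ℝ≥0 → Bool | f = e → g t = b} = Set.univ := by
          ext
          simp [hfe]
        exact (congrArg MeasurableSet this).mpr MeasurableSet.univ), rfl⟩
  have hset : {ω | (∀ f : F, X f s ω = η f) ∧ X e t ω = b} =
      ⋂ f : F, {ω | X f s ω = η f ∧ (f = e → X f t ω = b)} := by
    ext ω
    simp only [Set.mem_ofPred_eq, Set.mem_iInter, forall_and, forall_eq]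
  rw [hset, Set.ofPred_forall, measureReal_def, measureReal_def, h1, h2, ENNReal.toReal_prod,
    ENNReal.toReal_prod]
  have h3 : edgeTransition p ((t : ℝ) - s) (η e) b =
      ∏ f : F, if f = e then edgeTransition p ((t : ℝ) - s) (η e) b else 1 := by simp
  rw [h3, ← Finset.prod_mul_distrib]
  refine Finset.prod_congr rfl fun f _ => ?_
  by_cases hfe : f = e
  · subst hfe
    simp only [forall_const, if_true]
    change P.real _ = P.real _ * _
    rw [(hX.edge f).real_eq_and_eq hst, (hX.edge f).real_eq]
  · simp [hfe]

/-- The configuration percolates to level `n` at time `s`, and `e` closes between `s` and `t`. -/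
def closingEvent (ρ : V) (X : G.edgeSet → ℝ≥0 → Ω → Bool) (n : ℕ) (e : G.edgeSet) (s t : ℝ≥0) :
    Set Ω :=
  {ω | (OpenTo G ρ n fun e => X e s ω) ∧ X e s ω = true ∧ X e t ω = false}

/-- Decompose according to the states at time s of finitely many edges; given these, `e` closes with
probability (1 - p)(1 - exp(-(t - s))) ≤ t - s. -/
theorem IsDynamicalPercolation.real_closingEvent_le [G.LocallyFinite]
    (hX : IsDynamicalPercolation G p P X) (n : ℕ) (e : G.edgeSet) {s t : ℝ≥0} (hst : s ≤ t) :
    P.real (closingEvent ρ X n e s t) ≤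
      P.real {ω | OpenTo G ρ n fun e => X e s ω} * ((t : ℝ) - s) := by
  classical
  set F : Finset G.edgeSet := insert e (levelEdges G ρ n) with hF
  let e' : F := ⟨e, Finset.mem_insert_self _ _⟩
  let ext : (F → Bool) → G.edgeSet → Bool := fun η f => if h : f ∈ F then η ⟨f, h⟩ else false
  have hext : ∀ ω η, (∀ f : F, X f s ω = η f) →
      (OpenTo G ρ n (fun e => X e s ω) ↔ OpenTo G ρ n (ext η)) := by
    intro ω η h
    refine openTo_congr fun f hf => ?_
    have hfF : f ∈ F := Finset.mem_insert_of_mem hf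
    simp only [ext, dif_pos hfF]
    exact h ⟨f, hfF⟩
  set Q : Finset (F → Bool) := Finset.univ.filter fun η => η e' = true ∧ OpenTo G ρ n (ext η)
    with hQ
  have h1 : P.real (closingEvent ρ X n e s t) ≤
      ∑ η ∈ Q, P.real {ω | (∀ f : F, X f s ω = η f) ∧ X e' t ω = false} := by
    refine le_trans (measureReal_mono ?_ (measure_ne_top P _)) (measureReal_biUnion_finset_le Q _)
    rintro ω ⟨ho, h1, h2⟩
    refine Set.mem_biUnion (x := fun f : F => X f s ω) ?_ ⟨fun _ => rfl, h2⟩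
    simp only [hQ, Finset.coe_filter, Finset.mem_univ, true_and, Set.mem_ofPred_eq]
    exact ⟨h1, (hext ω _ fun _ => rfl).1 ho⟩
  have hmeas : ∀ η : F → Bool, MeasurableSet {ω | ∀ f : F, X f s ω = η f} := fun η => by
    rw [Set.ofPred_forall]
    exact MeasurableSet.iInter fun f => hX.measurableSet f s (η f)
  have h2 : ∑ η ∈ Q, P.real {ω | ∀ f : F, X f s ω = η f} ≤
      P.real {ω | OpenTo G ρ n fun e => X e s ω} := by
    rw [← measureReal_biUnion_finset (fun η _ ξ _ hne => ?_) (fun η _ => hmeas η)]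
    · refine measureReal_mono ?_
      intro ω hω
      obtain ⟨η, hη, h⟩ := Set.mem_iUnion₂.1 hω
      exact (hext ω η h).2 (Finset.mem_filter.1 hη).2.2
    · exact Set.disjoint_left.2 fun ω h1 h2 => hne (funext fun f => (h1 f).symm.trans (h2 f))
  have hd : 0 ≤ (t : ℝ) - s := sub_nonneg.2 (NNReal.coe_le_coe.2 hst)
  have htr : edgeTransition p ((t : ℝ) - s) true false ≤ (t : ℝ) - s := by
    rw [edgeTransition_apply]
    have h3 := Real.add_one_le_exp (-((t : ℝ) - s))
    have h4 : Real.exp (-((t : ℝ) - s)) ≤ 1 := Real.exp_le_one_iff.2 (by linarith)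
    have h5 : 0 ≤ (p : ℝ) := p.2.1
    have h6 : (p : ℝ) ≤ 1 := p.2.2
    simp only [statWeight, reduceCtorEq, Bool.false_eq_true, if_false, mul_zero, zero_add]
    nlinarith [mul_nonneg h5 (sub_nonneg.2 h4)]
  calc P.real (closingEvent ρ X n e s t)
      ≤ ∑ η ∈ Q, P.real {ω | (∀ f : F, X f s ω = η f) ∧ X e' t ω = false} := h1
    _ ≤ ∑ η ∈ Q, P.real {ω | ∀ f : F, X f s ω = η f} * ((t : ℝ) - s) := by
      refine Finset.sum_le_sum fun η hη => ?_
      rw [hX.real_forall_eq_and F e' hst η false, (Finset.mem_filter.1 hη).2.1]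
      exact mul_le_mul_of_nonneg_left htr measureReal_nonneg
    _ ≤ _ := by
      rw [← Finset.sum_mul]
      exact mul_le_mul_of_nonneg_right h2 hd

theorem IsDynamicalPercolation.measure_closingEvent_le [G.LocallyFinite]
    (hX : IsDynamicalPercolation G p P X) (n : ℕ) (e : G.edgeSet) {s t : ℝ≥0} (hst : s ≤ t) :
    P (closingEvent ρ X n e s t) ≤
      percolationMeasure G p {η | OpenTo G ρ n η} * ENNReal.ofReal ((t : ℝ) - s) := by
  have h := ENNReal.ofReal_le_ofReal (hX.real_closingEvent_le (ρ := ρ) n e hst)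
  rwa [ENNReal.ofReal_mul measureReal_nonneg, ofReal_measureReal, ofReal_measureReal,
    hX.measure_openTo] at h

/-- The grid version of the event that `e` closes before time `T` while the configuration
percolates to level `n`. -/
def gridClosing (ρ : V) (X : G.edgeSet → ℝ≥0 → Ω → Bool) (n : ℕ) (e : G.edgeSet) (T m : ℕ) : Set Ω :=
  ⋃ i ∈ Finset.range (T * m), closingEvent ρ X n e ((i : ℝ≥0) / m) (((i + 1 : ℕ) : ℝ≥0) / m)

/-- A union bound over T·m intervals of length 1/m. The mesh cancels, so the bound survives
refinement of the grid. -/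
theorem IsDynamicalPercolation.measure_gridClosing_le [G.LocallyFinite]
    (hX : IsDynamicalPercolation G p P X) (n : ℕ) (e : G.edgeSet) (T m : ℕ) :
    P (gridClosing ρ X n e T m) ≤ T * percolationMeasure G p {η | OpenTo G ρ n η} := by
  rcases Nat.eq_zero_or_pos m with rfl | hm
  · simp [gridClosing]
  refine (measure_biUnion_finset_le _ _).trans ?_
  have hm' : (0 : ℝ) < m := Nat.cast_pos.2 hm
  have : ∀ i ∈ Finset.range (T * m),
      P (closingEvent ρ X n e ((i : ℝ≥0) / m) (((i + 1 : ℕ) : ℝ≥0) / m)) ≤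
        percolationMeasure G p {η | OpenTo G ρ n η} * (m : ℝ≥0∞)⁻¹ := by
    intro i _
    refine (hX.measure_closingEvent_le n e (by gcongr; omega)).trans (le_of_eq ?_)
    congr 1
    push_cast
    rw [← sub_div, add_sub_cancel_left, one_div, ENNReal.ofReal_inv_of_pos hm',
      ENNReal.ofReal_natCast]
  refine (Finset.sum_le_sum this).trans (le_of_eq ?_)
  rw [Finset.sum_const, Finset.card_range, nsmul_eq_mul, Nat.cast_mul, mul_comm _ ((m : ℝ≥0∞)⁻¹),
    ← mul_assoc, mul_assoc (T : ℝ≥0∞), ENNReal.mul_inv_cancel (by simpa using hm.ne')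
    (ENNReal.natCast_ne_top m), mul_one]

/-- At a given edge there is a.s. no closing time at which the configuration just before
percolates. -/
theorem IsDynamicalPercolation.measure_closing_eq_zero [G.LocallyFinite]
    (hX : IsDynamicalPercolation G p P X)
    (hcrit : percolationMeasure G p {η | Percolates G ρ η} = 0) (e : G.edgeSet) (T : ℕ) :
    P {ω | ∀ n, ∀ᶠ m in atTop, ω ∈ gridClosing ρ X n e T m} = 0 := by
  have h1 : ∀ n, P {ω | ∀ n, ∀ᶠ m in atTop, ω ∈ gridClosing ρ X n e T m} ≤
      T * percolationMeasure G p {η | OpenTo G ρ n η} := by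
    intro n
    have hsub : {ω | ∀ n, ∀ᶠ m in atTop, ω ∈ gridClosing ρ X n e T m} ⊆
        ⋃ k : ℕ, ⋂ m ≥ k, gridClosing ρ X n e T m := by
      intro ω hω
      obtain ⟨k, hk⟩ := eventually_atTop.1 (hω n)
      exact Set.mem_iUnion.2 ⟨k, Set.mem_iInter₂.2 hk⟩
    refine (measure_mono hsub).trans ?_
    have hmono : Monotone fun k : ℕ => ⋂ m ≥ k, gridClosing ρ X n e T m := fun k l hkl =>
      Set.biInter_subset_biInter_left fun m hm => le_trans hkl hm
    -- A limit inferior of events is an increasing union of intersections, so it inherits the bound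
    -- that is uniform in the mesh.
    rw [hmono.directed_le.measure_iUnion]
    refine iSup_le fun k => ?_
    exact (measure_mono (Set.biInter_subset_of_mem (le_refl k))).trans
      (hX.measure_gridClosing_le n e T k)
  have h2 := tendsto_percolationMeasure_openTo (G := G) (ρ := ρ) (p := p)
  rw [hcrit] at h2
  have h3 := ENNReal.Tendsto.const_mul (a := (T : ℝ≥0∞)) h2 (Or.inr (ENNReal.natCast_ne_top T))
  rw [mul_zero] at h3
  exact le_antisymm (ge_of_tendsto' h3 h1) zero_le

end ExceptionalTimes

/-! ### Reaching every level versus percolating at a single time -/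

section CriticalCase

variable {V Ω : Type*} {G : SimpleGraph V} {ρ : V} {X : G.edgeSet → ℝ≥0 → Ω → Bool}

/-- The left limits of all edges are assembled into one configuration that serves every level. The
default `false` is not used on edges below any level. -/
theorem CadlagUpTo.exists_left [G.LocallyFinite] {ω : Ω} (h : ∀ n, CadlagUpTo ρ X n ω) (t : ℝ≥0) :
    ∃ η : G.edgeSet → Bool, ∀ n, ∀ᶠ s in 𝓝[<] t, ∀ e ∈ levelEdges G ρ n, X e s ω = η e := by
  classical
  refine ⟨fun e => if he : ∃ b, ∀ᶠ s in 𝓝[<] t, X e s ω = b then he.choose else false, fun n => ?_⟩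
  rw [Filter.eventually_all_finset]
  intro e he
  have hb : ∃ b, ∀ᶠ s in 𝓝[<] t, X e s ω = b := (h n e he t).2.imp fun b hb => by
    rwa [nhds_discrete, tendsto_pure] at hb
  simpa only [dif_pos hb] using hb.choose_spec

/-- If an edge closes at a time just before which the configuration percolates, then this is seen
on all fine grids. -/
theorem eventually_mem_gridClosing [G.LocallyFinite] {ω : Ω} {t : ℝ≥0} (ht : 0 < t)
    {η : G.edgeSet → Bool} {n : ℕ} {e : G.edgeSet} {T : ℕ} (hT : t ≤ T)
    (hη : ∀ᶠ s in 𝓝[<] t, ∀ f ∈ levelEdges G ρ n, X f s ω = η f) (hopen : OpenTo G ρ n η)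
    (he : ∀ᶠ s in 𝓝[<] t, X e s ω = true) (he' : ∀ᶠ s in 𝓝[≥] t, X e s ω = false) :
    ∀ᶠ m in atTop, ω ∈ gridClosing ρ X n e T m := by
  obtain ⟨a, ha, haU⟩ := (mem_nhdsLT_iff_exists_Ioo_subset' ht).1 (hη.and he)
  obtain ⟨b, hb, hbU⟩ := mem_nhdsGE_iff_exists_Ico_subset.1 he'
  have hat : (a : ℝ) < t := NNReal.coe_lt_coe.2 ha
  have htb : (t : ℝ) < b := NNReal.coe_lt_coe.2 hb
  have ht' : (0 : ℝ) < t := NNReal.coe_pos.2 ht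
  filter_upwards [tendsto_natCast_atTop_atTop.eventually_gt_atTop (1 / ((t : ℝ) - a)),
    tendsto_natCast_atTop_atTop.eventually_gt_atTop (1 / ((b : ℝ) - t)),
    eventually_gt_atTop 0] with m hm1 hm2 hm0
  rw [div_lt_iff₀ (by linarith)] at hm1 hm2
  have hm : (0 : ℝ) < m := Nat.cast_pos.2 hm0
  -- The grid cell with i/m < t ≤ (i + 1)/m. The mesh is smaller than both t - a and b - t, so its
  -- endpoints see the left limit and the new state respectively.
  obtain ⟨i, hi⟩ : ∃ i, ⌈(t : ℝ) * m⌉₊ = i + 1 :=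
    Nat.exists_eq_succ_of_ne_zero (Nat.ceil_pos.2 (mul_pos ht' hm)).ne'
  have h1 : (t : ℝ) * m ≤ (i + 1 : ℕ) := hi ▸ Nat.le_ceil _
  have h2 : (i : ℝ) < t * m := Nat.lt_ceil.1 (by omega)
  have hiT : i < T * m := by
    have h3 : ⌈(t : ℝ) * m⌉₊ ≤ T * m := by
      refine Nat.ceil_le.2 ?_
      push_cast
      exact mul_le_mul_of_nonneg_right (by exact_mod_cast hT) hm.le
    omega
  have hleft : ((i : ℝ≥0) / m) ∈ Set.Ioo a t := by
    constructor <;> rw [← NNReal.coe_lt_coe] <;> push_cast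
    · rw [lt_div_iff₀ hm]
      push_cast at h1
      linarith
    · rwa [div_lt_iff₀ hm]
  have hright : (((i + 1 : ℕ) : ℝ≥0) / m) ∈ Set.Ico t b := by
    constructor
    · rw [← NNReal.coe_le_coe]
      push_cast at h1 ⊢
      rwa [le_div_iff₀ hm]
    · rw [← NNReal.coe_lt_coe]
      push_cast
      rw [div_lt_iff₀ hm]
      linarith
  refine Set.mem_biUnion (Finset.mem_coe.2 (Finset.mem_range.2 hiT)) ⟨?_, (haU hleft).2, hbU hright⟩
  exact (openTo_congr (haU hleft).1).2 hopen

/-- If the configuration reaches every level during a compact set of times, then it percolates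
at one of these times, unless an edge closes at a time just before which it percolates. -/
theorem mem_percolatesDuring_or_gridClosing [G.LocallyFinite] {ω : Ω}
    (h : ∀ n, CadlagUpTo ρ X n ω) {D : Set ℝ≥0} (hD : IsCompact D)
    (hω : ∀ n, ω ∈ hitEvent ρ X n D) :
    ω ∈ percolatesDuring G ρ X D ∨ ∃ k, ∃ e ∈ levelEdges G ρ k, ∃ T : ℕ,
      ∀ n, ∀ᶠ m in atTop, ω ∈ gridClosing ρ X n e T m := by
  set A : ℕ → Set ℝ≥0 := fun n => {t | t ∈ D ∧ OpenTo G ρ n fun e => X e t ω} with hA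
  have hanti : ∀ {m n}, m ≤ n → A n ⊆ A m := fun hmn t ht => ⟨ht.1, ht.2.anti hmn⟩
  have hAD : ∀ n, closure (A n) ⊆ D := fun n =>
    closure_minimal (fun t ht => ht.1) hD.isClosed
  -- The sets `A n` need not be closed, as paths are only càdlàg; hence closures, and a limit time
  -- at which percolation may fail.
  obtain ⟨t, ht⟩ := IsCompact.nonempty_iInter_of_sequence_nonempty_isCompact_isClosed
    (fun n => closure (A n)) (fun n => closure_mono (hanti n.le_succ))
    (fun n => (hω n).imp fun s hs => subset_closure hs)
    (hD.of_isClosed_subset isClosed_closure (hAD 0)) (fun n => isClosed_closure)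
  rw [Set.mem_iInter] at ht
  by_cases hperc : ∀ n, OpenTo G ρ n fun e => X e t ω
  · exact Or.inl (Set.mem_iUnion₂.2 ⟨t, hAD 0 (ht 0), percolates_iff.2 hperc⟩)
  right
  push Not at hperc
  obtain ⟨k, hk⟩ := hperc
  -- Accumulation at `t` from the right, or at `t` itself, would by right-continuity give level `k`
  -- at time `t`, which is excluded. Taking level `max k n` serves both `k` and `n`.
  have hfreq : ∀ n, ∃ᶠ s in 𝓝[<] t, s ∈ A n := by
    intro n
    have h1 := mem_closure_iff_frequently.1 (ht (max k n))
    rw [← nhdsLT_sup_nhdsGE, frequently_sup] at h1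
    rcases h1 with h1 | h1
    · exact h1.mono fun s hs => hanti (le_max_right k n) hs
    · obtain ⟨s, hs, hs'⟩ := (h1.and_eventually ((h _).eventually_right t)).exists
      exact absurd (((openTo_congr hs').1 hs.2).anti (le_max_left k n)) hk
  obtain ⟨η, hη⟩ := CadlagUpTo.exists_left h t
  have hopen : ∀ n, OpenTo G ρ n η := fun n => by
    obtain ⟨s, hs, hs'⟩ := ((hfreq n).and_eventually (hη n)).exists
    exact (openTo_congr hs').1 hs.2
  have ht0 : 0 < t := by
    rw [pos_iff_ne_zero]
    rintro rfl
    simpa using (hfreq 0)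
  -- A path to level `k` open in the left limit cannot remain open at `t`, so one of its edges
  -- closes exactly at `t`.
  obtain ⟨u, hu⟩ := openTo_iff_exists_level.1 (hopen k)
  have hex : ∃ e ∈ u.edges, X e t ω = false := by
    by_contra hne
    push Not at hne
    exact hk (openTo_iff_exists_level.2 ⟨u, fun e he => by simpa using hne e he⟩)
  obtain ⟨e, heu, het⟩ := hex
  have hek := u.edges_subset heu
  obtain ⟨T, hT⟩ := exists_nat_ge t
  refine ⟨k, e, hek, T, fun n => eventually_mem_gridClosing ht0 hT (hη n) (hopen n) ?_ ?_⟩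
  · exact (hη k).mono fun s hs => (hs e hek).trans (hu e heu)
  · exact ((h k).eventually_right t).mono fun s hs => (hs e hek).trans het

variable [MeasurableSpace Ω] {p : I} {P : Measure Ω}

theorem IsDynamicalPercolation.percolatesDuring_ae_eq [G.LocallyFinite] [IsProbabilityMeasure P]
    (hX : IsDynamicalPercolation G p P X)
    (hcrit : percolationMeasure G p {η | Percolates G ρ η} = 0) {D : Set ℝ≥0} (hD : IsCompact D) :
    percolatesDuring G ρ X D =ᵐ[P] ⋂ n, hitEvent ρ X n D := by
  have hnull : ∀ᵐ ω ∂P, ∀ k, ∀ e ∈ levelEdges G ρ k, ∀ T : ℕ,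
      ¬ ∀ n, ∀ᶠ m in atTop, ω ∈ gridClosing ρ X n e T m := by
    rw [ae_all_iff]
    intro k
    refine (ae_ball_iff (levelEdges G ρ k).countable_toSet).2 fun e _ => ae_all_iff.2 fun T => ?_
    simpa only [ae_iff, not_not] using hX.measure_closing_eq_zero hcrit e T
  filter_upwards [hX.ae_cadlagUpTo (ρ := ρ), hnull] with ω hc hn
  refine propext ⟨fun h => Set.mem_iInter.2 fun n => percolatesDuring_subset_hitEvent D n h,
    fun h => ?_⟩
  rcases mem_percolatesDuring_or_gridClosing hc hD (Set.mem_iInter.1 h) with h | ⟨k, e, he, T, h⟩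
  · exact h
  · exact absurd h (hn k e he T)

theorem IsDynamicalPercolation.nullMeasurableSet_hitEvent [G.LocallyFinite]
    (hX : IsDynamicalPercolation G p P X) (n : ℕ) (D : Set ℝ≥0) :
    NullMeasurableSet (hitEvent ρ X n D) P := by
  obtain ⟨D', hsub, hcount, hD'⟩ := exists_countable_dense_right D
  exact (hX.measurableSet_hitEvent n hcount).nullMeasurableSet.congr
    (hX.hitEvent_ae_eq hsub hD' n).symm

end CriticalCase

/-! ### The capacity lower bound -/

section LowerBound

/-- The time difference changes by at most 2δ; the summand 1 of `rate` is absorbed because exp(2δ) ≥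
1. -/
theorem rate_le_of_abs_sub_le (p : I) {δ : ℝ} (hδ : 0 ≤ δ) {s t s' t' : ℝ≥0}
    (hs : |(s' : ℝ) - s| ≤ δ) (ht : |(t' : ℝ) - t| ≤ δ) :
    rate p s' t' ≤ Real.exp (2 * δ) * rate p s t := by
  have h1 : -|(s' : ℝ) - t'| ≤ 2 * δ + -|(s : ℝ) - t| := by
    have := abs_le.1 hs
    have := abs_le.1 ht
    have := le_abs_self ((s' : ℝ) - t')
    have := neg_abs_le ((s' : ℝ) - t')
    have : |(s : ℝ) - t| ≤ |(s' : ℝ) - t'| + 2 * δ := abs_le.2 ⟨by linarith, by linarith⟩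
    linarith
  have h2 := Real.exp_le_exp.2 h1
  rw [Real.exp_add] at h2
  have h3 : 1 ≤ Real.exp (2 * δ) := Real.one_le_exp (by linarith)
  have h4 : 0 ≤ (1 - (p : ℝ)) / p := div_nonneg (by linarith [p.2.2]) p.2.1
  unfold rate
  nlinarith [mul_le_mul_of_nonneg_left h2 h4]

theorem exists_finite_approx {D : Set ℝ≥0} (hD : IsCompact D) (hne : D.Nonempty) {δ : ℝ}
    (hδ : 0 < δ) :
    ∃ (S : Finset ℝ≥0) (φ : ℝ≥0 → S), (S : Set ℝ≥0) ⊆ D ∧ (∀ s, MeasurableSet (φ ⁻¹' {s})) ∧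
      ∀ t ∈ D, |((φ t : ℝ≥0) : ℝ) - t| ≤ δ := by
  classical
  obtain ⟨F, hFD, hF, hcov⟩ := hD.finite_cover_balls hδ
  have hFne : F.Nonempty := by
    obtain ⟨t, ht⟩ := hne
    obtain ⟨s, hs, -⟩ := Set.mem_iUnion₂.1 (hcov ht)
    exact ⟨s, hs⟩
  obtain ⟨e, rfl⟩ := hF.countable.exists_eq_range hFne
  choose! k hk using fun s (hs : s ∈ Set.range e) => hs
  set N := hF.toFinset.sup k with hN
  have hmem : ∀ t, SimpleFunc.nearestPt e N t ∈ hF.toFinset := fun t => by simp [SimpleFunc.nearestPt]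
  refine ⟨hF.toFinset, fun t => ⟨SimpleFunc.nearestPt e N t, hmem t⟩, by simpa using hFD,
    fun s => ?_, fun t ht => ?_⟩
  · have : (fun t => (⟨SimpleFunc.nearestPt e N t, hmem t⟩ : hF.toFinset)) ⁻¹' {s} =
        SimpleFunc.nearestPt e N ⁻¹' {(s : ℝ≥0)} := by
      ext t
      simp [Subtype.ext_iff]
    rw [this]
    exact SimpleFunc.measurableSet_fiber _ _
  · obtain ⟨s, hs, hts⟩ := Set.mem_iUnion₂.1 (hcov ht)
    have h1 : k s ≤ N := Finset.le_sup (f := k) (hF.mem_toFinset.2 hs)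
    have h2 := SimpleFunc.edist_nearestPt_le e t h1
    rw [hk s hs, edist_dist, edist_dist, ENNReal.ofReal_le_ofReal_iff dist_nonneg] at h2
    rw [← NNReal.dist_eq]
    rw [Metric.mem_ball, dist_comm] at hts
    exact h2.trans hts.le

theorem lintegral_comp_eq_sum {A K : Type*} [MeasurableSpace A] [Fintype K] (μ : Measure A)
    {g : A → K} (hg : ∀ x, MeasurableSet (g ⁻¹' {x})) (f : K → ℝ≥0∞) :
    ∫⁻ z, f (g z) ∂μ = ∑ x, f x * μ (g ⁻¹' {x}) := by
  let _ : MeasurableSpace K := ⊤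
  have : DiscreteMeasurableSpace K := ⟨fun _ => trivial⟩
  have hm : Measurable g := measurable_to_countable' hg
  rw [← lintegral_map (f := f) measurable_from_top hm, lintegral_fintype]
  exact Finset.sum_congr rfl fun x _ => by rw [Measure.map_apply hm trivial]

variable {V Ω : Type*} [MeasurableSpace Ω] {G : SimpleGraph V} {ρ : V} {p : I} {P : Measure Ω}
  {X : G.edgeSet → ℝ≥0 → Ω → Bool}

theorem measurableSet_level_preimage {n : ℕ} (u : Level G ρ n) :
    MeasurableSet (Ray.level n ⁻¹' {u}) := by
  have : Ray.level n ⁻¹' {u} = ⋂ i : Fin (n + 1), {v : Ray G ρ | v.toFun i = u.1 i} := by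
    ext v
    simp only [Set.mem_preimage, Set.mem_singleton_iff, Set.mem_iInter, Set.mem_ofPred_eq]
    exact Subtype.ext_iff.trans funext_iff
  rw [this]
  exact MeasurableSet.iInter fun i =>
    ((Ray.isLocallyConstant_apply (i : ℕ)).isOpen_fiber _).measurableSet

/-- The second moment bound for the image of `μ` on the vertices of level n and a finite net of `D`.
Truncating rays at level n leaves `meetNat n` unchanged, so only the rounding of times costs a
factor. -/
theorem IsDynamicalPercolation.one_le_measure_mul_energy [G.LocallyFinite] [IsProbabilityMeasure P]
    (hG : G.IsAcyclic) (hp0 : 0 < p) (hp1 : p < 1) (hX : IsDynamicalPercolation G p P X) (n : ℕ)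
    {D : Set ℝ≥0} (hD : IsCompact D) (μ : Measure (Ray G ρ × ℝ≥0)) [IsProbabilityMeasure μ]
    (hμ : μ (Set.univ ×ˢ D)ᶜ = 0) :
    1 ≤ P (hitEvent ρ X n D) * (2 * energy (kernelH p) μ) := by
  have hne : D.Nonempty := by
    by_contra h
    rw [Set.not_nonempty_iff_eq_empty] at h
    simp [h] at hμ
  -- The kernel has exponent at most n, so this δ keeps the total distortion exp(2δ)^n below 2; n +
  -- 1 avoids a division by zero.
  set δ : ℝ := Real.log 2 / (2 * (n + 1)) with hδ
  have hδ0 : 0 < δ := div_pos (Real.log_pos one_lt_two) (by positivity)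
  have hexp : ∀ k ≤ n, Real.exp (2 * δ) ^ k ≤ 2 := by
    intro k hk
    rw [← Real.exp_nat_mul, ← Real.le_log_iff_exp_le two_pos]
    have h1 : (k : ℝ) ≤ n := Nat.cast_le.2 hk
    have h2 : δ * (2 * (n + 1)) = Real.log 2 := div_mul_cancel₀ _ (by positivity)
    nlinarith
  obtain ⟨S, φ, hSD, hφm, hφ⟩ := exists_finite_approx hD hne hδ0
  let g : Ray G ρ × ℝ≥0 → Level G ρ n × S := fun z => (z.1.level n, φ z.2)
  have hg : ∀ x, MeasurableSet (g ⁻¹' {x}) := by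
    rintro ⟨u, s⟩
    have : g ⁻¹' {(u, s)} = (Ray.level n ⁻¹' {u}) ×ˢ (φ ⁻¹' {s}) := by
      ext z
      simp [g]
    rw [this]
    exact (measurableSet_level_preimage u).prod (hφm s)
  set r : Level G ρ n × S → Level G ρ n × S → ℝ :=
    fun x y => rate p x.2 y.2 ^ meetNat n x.1.rep y.1.rep with hr
  have hr0 : ∀ x y, 0 ≤ r x y := fun x y => pow_nonneg (zero_le_one.trans (one_le_rate p _ _)) _
  have hsum : ∑ x, μ.real (g ⁻¹' {x}) = 1 := by
    have h1 := lintegral_comp_eq_sum μ hg fun _ => 1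
    simp only [lintegral_one, measure_univ, one_mul] at h1
    simp only [measureReal_def]
    rw [← ENNReal.toReal_sum fun x _ => measure_ne_top μ _, ← h1, ENNReal.toReal_one]
  have h1 := hX.one_le_hit_mul_energy hG hp0 n S hsum
  have h2 : ENNReal.ofReal (∑ x, ∑ y, μ.real (g ⁻¹' {x}) * μ.real (g ⁻¹' {y}) * r x y) =
      ∫⁻ z, ∫⁻ w, ENNReal.ofReal (r (g z) (g w)) ∂μ ∂μ := by
    rw [lintegral_comp_eq_sum μ hg fun x => ∫⁻ w, ENNReal.ofReal (r x (g w)) ∂μ]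
    have h0 : ∀ x y, 0 ≤ μ.real (g ⁻¹' {x}) * μ.real (g ⁻¹' {y}) * r x y := fun x y =>
      mul_nonneg (mul_nonneg measureReal_nonneg measureReal_nonneg) (hr0 x y)
    rw [ENNReal.ofReal_sum_of_nonneg fun x _ => Finset.sum_nonneg fun y _ => h0 x y]
    refine Finset.sum_congr rfl fun x _ => ?_
    rw [lintegral_comp_eq_sum μ hg fun y => ENNReal.ofReal (r x y), Finset.sum_mul,
      ENNReal.ofReal_sum_of_nonneg fun y _ => h0 x y]
    refine Finset.sum_congr rfl fun y _ => ?_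
    rw [ENNReal.ofReal_mul (mul_nonneg measureReal_nonneg measureReal_nonneg),
      ENNReal.ofReal_mul measureReal_nonneg, ofReal_measureReal, ofReal_measureReal]
    ring
  have hDae : ∀ᵐ z ∂μ, z.2 ∈ D := by
    rw [ae_iff]
    refine measure_mono_null (fun z hz => ?_) hμ
    simpa using hz
  have h3 : ∫⁻ z, ∫⁻ w, ENNReal.ofReal (r (g z) (g w)) ∂μ ∂μ ≤ 2 * energy (kernelH p) μ := by
    rw [energy, ← lintegral_const_mul' _ _ ENNReal.ofNat_ne_top]
    refine lintegral_mono_ae (hDae.mono fun z hz => ?_)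
    rw [← lintegral_const_mul' _ _ ENNReal.ofNat_ne_top]
    refine lintegral_mono_ae (hDae.mono fun w hw => ?_)
    have h4 : r (g z) (g w) ≤ 2 * kernelTrunc p n z w := by
      change rate p (φ z.2) (φ w.2) ^ meetNat n (z.1.level n).rep (w.1.level n).rep ≤ _
      rw [meetNat_rep_level, kernelTrunc]
      have h5 := rate_le_of_abs_sub_le p hδ0.le (hφ _ hz) (hφ _ hw)
      refine (pow_le_pow_left₀ (zero_le_one.trans (one_le_rate p _ _)) h5 _).trans ?_
      rw [mul_pow]
      refine mul_le_mul_of_nonneg_right (hexp _ ?_)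
        (pow_nonneg (zero_le_one.trans (one_le_rate p _ _)) _)
      rw [← Nat.cast_le (α := ℕ∞), natCast_meetNat]
      exact min_le_left _ _
    refine (ENNReal.ofReal_le_ofReal h4).trans ?_
    rw [ENNReal.ofReal_mul zero_le_two, ENNReal.ofReal_ofNat, kernelH_eq_iSup hp0 hp1]
    gcongr
    exact le_iSup (fun n => ENNReal.ofReal (kernelTrunc p n z w)) n
  have h6 := ENNReal.ofReal_le_ofReal h1
  rw [ENNReal.ofReal_one, ENNReal.ofReal_mul measureReal_nonneg, ofReal_measureReal] at h6
  refine h6.trans (mul_le_mul' (measure_mono fun ω => ?_) (h2.trans_le h3))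
  rintro ⟨t, ht, h⟩
  exact ⟨t, hSD ht, h⟩

theorem IsDynamicalPercolation.half_capacity_le [G.LocallyFinite] [IsProbabilityMeasure P]
    (hG : G.IsAcyclic) (hp0 : 0 < p) (hp1 : p < 1) (hX : IsDynamicalPercolation G p P X) (n : ℕ)
    {D : Set ℝ≥0} (hD : IsCompact D) :
    1 / 2 * capacity (kernelH (G := G) (ρ := ρ) p) (Set.univ ×ˢ D) ≤ P (hitEvent ρ X n D) := by
  have h : capacity (kernelH (G := G) (ρ := ρ) p) (Set.univ ×ˢ D) ≤ 2 * P (hitEvent ρ X n D) := by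
    rw [capacity, ENNReal.inv_le_iff_inv_le]
    refine le_iInf₂ fun μ hμ => ?_
    rw [← one_div]
    refine ENNReal.div_le_of_le_mul ?_
    refine (hX.one_le_measure_mul_energy hG hp0 hp1 n hD (μ : Measure (Ray G ρ × ℝ≥0)) hμ).trans (le_of_eq ?_)
    ring
  calc _ ≤ 1 / 2 * (2 * P (hitEvent ρ X n D)) := by gcongr
    _ = _ := by
      rw [← mul_assoc, one_div, ENNReal.inv_mul_cancel two_ne_zero ENNReal.ofNat_ne_top, one_mul]

/-- The bound at level n is uniform in n, and the events of reaching level n decrease to percolation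
during `D` up to a null set. -/
theorem IsDynamicalPercolation.capacity_le_measure [G.LocallyFinite] [IsProbabilityMeasure P]
    (hG : G.IsAcyclic) (hp0 : 0 < p) (hp1 : p < 1) (hX : IsDynamicalPercolation G p P X)
    (hcrit : percolationMeasure G p {η | Percolates G ρ η} = 0) {D : Set ℝ≥0} (hD : IsCompact D) :
    1 / 2 * capacity (kernelH (G := G) (ρ := ρ) p) (Set.univ ×ˢ D) ≤
      P (percolatesDuring G ρ X D) := by
  rw [measure_congr (hX.percolatesDuring_ae_eq hcrit hD)]
  refine ge_of_tendsto' (tendsto_measure_iInter_atTop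
    (fun n => hX.nullMeasurableSet_hitEvent n D) ?_ ⟨0, measure_ne_top _ _⟩)
    fun n => hX.half_capacity_le hG hp0 hp1 n hD
  rintro m n hmn ω ⟨t, ht, h⟩
  exact ⟨t, ht, h.anti hmn⟩

end LowerBound

end DynPerc

theorem mainTheorem1 {V Ω : Type*} [MeasurableSpace Ω]
    (G : SimpleGraph V) [G.LocallyFinite] (hG : G.IsTree) (ρ : V)
    (p : unitInterval) (hp0 : 0 < p) (hp1 : p < 1)
    (P : MeasureTheory.Measure Ω) [MeasureTheory.IsProbabilityMeasure P]
    (X : G.edgeSet → NNReal → Ω → Bool) (hX : DynPerc.IsDynamicalPercolation G p P X)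
    (D : Set NNReal) (hD : IsCompact D) :
    P (DynPerc.percolatesDuring G ρ X D) ≤
        512 * DynPerc.capacity (DynPerc.kernelH (G := G) (ρ := ρ) p) (Set.univ ×ˢ D) ∧
      (DynPerc.percolationMeasure G p {η | DynPerc.Percolates G ρ η} = 0 →
        MeasureTheory.NullMeasurableSet (DynPerc.percolatesDuring G ρ X D) P ∧
          1 / 2 * DynPerc.capacity (DynPerc.kernelH (G := G) (ρ := ρ) p) (Set.univ ×ˢ D) ≤
            P (DynPerc.percolatesDuring G ρ X D)) := by
  refine ⟨hX.measure_le_capacity hG.isAcyclic hp0 hp1 hD, fun hcrit => ⟨?_, ?_⟩⟩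
  · exact (NullMeasurableSet.iInter fun n => hX.nullMeasurableSet_hitEvent n D).congr
      (hX.percolatesDuring_ae_eq hcrit hD).symm
  · exact hX.capacity_le_measure hG.isAcyclic hp0 hp1 hcrit hD
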